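/- **Setting.** Let $K,R\ge 0$ be fixed integers and $\beta^0\in\mathbb R^K$. On a probability space consider, along a sequence of panel sizes $(N,T)$ with $N,T\to\infty$ and $N/T\to\kappa^2$, $0<\kappa<\infty$, the model $$Y=\beta^0\cdot X+\lambda^0 f^{0\prime}+e,\qquad \beta\cdot X=\sum_{k=1}^K\beta_kX_k,$$ where $X_k$ $(k=1,\dots,K)$ and $e$ are random $N\times T$ matrices, and $\lambda^0$ and $f^0$ are random $N\times R$ and $T\times R$ matrices (the dependence on $(N,T)$ is suppressed). Write $\|\cdot\|$ for the Euclidean norm of vectors and the spectral norm of matrices, $X_{it}=(X_{1,it},\dots,X_{K,it})'$, and $M_A=\mathbb I-A(A'A)^\dagger A'$ with $\dagger$ the Moore–Penrose pseudoinverse. Define the profile objective function $$L_{NT}(\beta)=\min_{\lambda\in\mathbb R^{N\times R},\,f\in\mathbb R^{T\times R}}\frac1{NT}\operatorname{Tr}\big[(Y-\beta\cdot X-\lambda f')'(Y-\beta\cdot X-\lambda f')\big],$$ the $K\times K$ matrix $W_{NT}$ with entries $W_{NT,k_1k_2}=(NT)^{-1}\operatorname{Tr}(M_{f^0}X_{k_1}'M_{\lambda^0}X_{k_2})$,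 and the $K$-vector $C_{NT}$ with entries $C_{NT,k}=C^{(1)}_k+C^{(2)}_k$, where $$C^{(1)}_k=\tfrac1{\sqrt{NT}}\operatorname{Tr}(M_{f^0}e'M_{\lambda^0}X_k),$$ $$\begin{aligned}C^{(2)}_k=-\tfrac1{\sqrt{NT}}\Big[&\operatorname{Tr}\big(eM_{f^0}e'M_{\lambda^0}X_kf^0(f^{0\prime}f^0)^{-1}(\lambda^{0\prime}\lambda^0)^{-1}\lambda^{0\prime}\big)\\&+\operatorname{Tr}\big(e'M_{\lambda^0}eM_{f^0}X_k'\lambda^0(\lambda^{0\prime}\lambda^0)^{-1}(f^{0\prime}f^0)^{-1}f^{0\prime}\big)\\&+\operatorname{Tr}\big(e'M_{\lambda^0}X_kM_{f^0}e'\lambda^0(\lambda^{0\prime}\lambda^0)^{-1}(f^{0\prime}f^0)^{-1}f^{0\prime}\big)\Big].\end{aligned}$$ Define the remainder $R_{NT}(\beta)$ by $$L_{NT}(\beta)=L_{NT}(\beta^0)-\tfrac2{\sqrt{NT}}(\beta-\beta^0)'C_{NT}+(\beta-\beta^0)'W_{NT}(\beta-\beta^0)+\tfrac1{NT}R_{NT}(\beta).$$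 **Assumptions.** The probability limits of $\lambda^{0\prime}\lambda^0/N$, of $f^{0\prime}f^0/T$ and of $(NT)^{-1}\sum_{i=1}^N\sum_{t=1}^TX_{it}X_{it}'$ exist and are (almost surely, if random) positive definite; and $\|e\|=o_p(N^{2/3})$. **Theorem.** Wherever $L_{NT}$ is differentiable, so is $R_{NT}$, and $$\nabla L_{NT}(\beta)=2W_{NT}(\beta-\beta^0)-\frac2{\sqrt{NT}}C_{NT}+\frac1{NT}\nabla R_{NT}(\beta).$$ For every sequence $\eta_{NT}\to0$, with probability approaching one $L_{NT}$ is differentiable at every $\beta$ with $\|\beta-\beta^0\|\le\eta_{NT}$, and $$\sup_{\{\beta:\|\beta-\beta^0\|\le\eta_{NT}\}}\frac{\|\nabla R_{NT}(\beta)\|}{\sqrt{NT}\,\big(1+\sqrt{NT}\,\|\beta-\beta^0\|\big)}=o_p(1).$$ -/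

import Mathlib

open MeasureTheory Filter Topology Matrix
open scoped ENNReal Gradient

noncomputable section

namespace PanelIFE

/-! ### Matrix preliminaries -/

/-- The spectral norm (operator norm for the Euclidean norms) of a real `m × n` matrix. -/
def specNorm {m n : ℕ} (A : Matrix (Fin m) (Fin n) ℝ) : ℝ :=
  ‖LinearMap.toContinuousLinearMap (Matrix.toEuclideanLin A)‖

theorem gram_isHermitian {m n : ℕ} (A : Matrix (Fin m) (Fin n) ℝ) : (Aᵀ * A).IsHermitian := by
  simpa [conjTranspose_eq_transpose_of_trivial] using isHermitian_conjTranspose_mul_self A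

/-- The Moore-Penrose pseudoinverse of a symmetric real matrix: invert the non-zero eigenvalues
in a spectral decomposition (recall `0⁻¹ = 0`). -/
def symmPinv {n : ℕ} {G : Matrix (Fin n) (Fin n) ℝ} (hG : G.IsHermitian) :
    Matrix (Fin n) (Fin n) ℝ :=
  (hG.eigenvectorUnitary : Matrix (Fin n) (Fin n) ℝ) *
    Matrix.diagonal (fun i => (hG.eigenvalues i)⁻¹) *
    star (hG.eigenvectorUnitary : Matrix (Fin n) (Fin n) ℝ)

/-- `symmPinv` satisfies the four Penrose equations, which characterize the pseudoinverse. -/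
theorem symmPinv_penrose {n : ℕ} {G : Matrix (Fin n) (Fin n) ℝ} (hG : G.IsHermitian) :
    G * symmPinv hG * G = G ∧ symmPinv hG * G * symmPinv hG = symmPinv hG ∧
      (G * symmPinv hG)ᵀ = G * symmPinv hG ∧ (symmPinv hG * G)ᵀ = symmPinv hG * G := by
  have h1 : G = Unitary.conjStarAlgAut ℝ _ hG.eigenvectorUnitary
      (diagonal hG.eigenvalues) := hG.spectral_theorem
  have h2 : symmPinv hG = Unitary.conjStarAlgAut ℝ _ hG.eigenvectorUnitary
      (diagonal fun i => (hG.eigenvalues i)⁻¹) := rfl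
  generalize symmPinv hG = H at h2
  generalize hG.eigenvalues = d at h1 h2
  generalize hG.eigenvectorUnitary = U at h1 h2
  subst h1 h2
  have key : ∀ x : ℝ, x * x⁻¹ * x = x := fun x => mul_inv_mul_cancel x
  have key' : ∀ x : ℝ, x⁻¹ * x * x⁻¹ = x⁻¹ := fun x => by
    simpa using mul_inv_mul_cancel x⁻¹
  refine ⟨?_, ?_, ?_, ?_⟩
  · simp only [← map_mul, diagonal_mul_diagonal, key]
  · simp only [← map_mul, diagonal_mul_diagonal, key']
  · rw [← conjTranspose_eq_transpose_of_trivial, ← star_eq_conjTranspose, ← map_mul, ← map_star,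
      star_eq_conjTranspose, diagonal_mul_diagonal, diagonal_conjTranspose, star_trivial]
  · rw [← conjTranspose_eq_transpose_of_trivial, ← star_eq_conjTranspose, ← map_mul, ← map_star,
      star_eq_conjTranspose, diagonal_mul_diagonal, diagonal_conjTranspose, star_trivial]

/-- The annihilator `M_A = 𝕀 - A (A'A)† A'`. -/
def annih {m n : ℕ} (A : Matrix (Fin m) (Fin n) ℝ) : Matrix (Fin m) (Fin m) ℝ :=
  1 - A * symmPinv (gram_isHermitian A) * Aᵀ

/-! ### The profile objective function and its quadratic approximation, for given data -/

variable {N T K R : ℕ}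

/-- The linear combination `β · X = ∑ₖ βₖ Xₖ` of the regressor matrices. -/
def lincomb (β : EuclideanSpace ℝ (Fin K)) (X : Fin K → Matrix (Fin N) (Fin T) ℝ) :
    Matrix (Fin N) (Fin T) ℝ :=
  ∑ k, β k • X k

/-- The least squares objective
`𝓛_NT(β, λ, f) = (NT)⁻¹ Tr[(Y - β·X - λ f')' (Y - β·X - λ f')]`. -/
def lsObjective (Y : Matrix (Fin N) (Fin T) ℝ) (X : Fin K → Matrix (Fin N) (Fin T) ℝ)
    (β : EuclideanSpace ℝ (Fin K)) (lam : Matrix (Fin N) (Fin R) ℝ)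
    (f : Matrix (Fin T) (Fin R) ℝ) : ℝ :=
  ((N : ℝ) * T)⁻¹ *
    ((Y - lincomb β X - lam * fᵀ)ᵀ * (Y - lincomb β X - lam * fᵀ)).trace

/-- The profile objective `L_NT(β) = min_{λ, f} 𝓛_NT(β, λ, f)` with `R` factors. -/
def profileObjective (R : ℕ) (Y : Matrix (Fin N) (Fin T) ℝ)
    (X : Fin K → Matrix (Fin N) (Fin T) ℝ) (β : EuclideanSpace ℝ (Fin K)) : ℝ :=
  ⨅ p : Matrix (Fin N) (Fin R) ℝ × Matrix (Fin T) (Fin R) ℝ, lsObjective Y X β p.1 p.2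

/-- The approximated Hessian, `W_{k₁ k₂} = (NT)⁻¹ Tr(M_f X_{k₁}' M_λ X_{k₂})`. -/
def hessW (lam : Matrix (Fin N) (Fin R) ℝ) (f : Matrix (Fin T) (Fin R) ℝ)
    (X : Fin K → Matrix (Fin N) (Fin T) ℝ) : Matrix (Fin K) (Fin K) ℝ :=
  Matrix.of fun k₁ k₂ =>
    ((N : ℝ) * T)⁻¹ * (annih f * (X k₁)ᵀ * annih lam * X k₂).trace

/-- `C⁽¹⁾(λ, f, Xₖ, e)`. -/
def score1 (lam : Matrix (Fin N) (Fin R) ℝ) (f : Matrix (Fin T) (Fin R) ℝ)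
    (Xk e : Matrix (Fin N) (Fin T) ℝ) : ℝ :=
  (√((N : ℝ) * T))⁻¹ * (annih f * eᵀ * annih lam * Xk).trace

/-- `C⁽²⁾(λ, f, Xₖ, e)`. -/
def score2 (lam : Matrix (Fin N) (Fin R) ℝ) (f : Matrix (Fin T) (Fin R) ℝ)
    (Xk e : Matrix (Fin N) (Fin T) ℝ) : ℝ :=
  -((√((N : ℝ) * T))⁻¹ *
    ((e * annih f * eᵀ * annih lam * Xk * f * (fᵀ * f)⁻¹ * (lamᵀ * lam)⁻¹ * lamᵀ).trace
      + (eᵀ * annih lam * e * annih f * Xkᵀ * lam * (lamᵀ * lam)⁻¹ * (fᵀ * f)⁻¹ * fᵀ).trace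
      + (eᵀ * annih lam * Xk * annih f * eᵀ * lam * (lamᵀ * lam)⁻¹ * (fᵀ * f)⁻¹ * fᵀ).trace))

/-- The approximated score `C_NT`, with entries `C⁽¹⁾ + C⁽²⁾`. -/
def scoreC (lam : Matrix (Fin N) (Fin R) ℝ) (f : Matrix (Fin T) (Fin R) ℝ)
    (X : Fin K → Matrix (Fin N) (Fin T) ℝ) (e : Matrix (Fin N) (Fin T) ℝ) :
    EuclideanSpace ℝ (Fin K) :=
  WithLp.toLp 2 fun k => score1 lam f (X k) e + score2 lam f (X k) e

/-- The quadratic approximation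
`L_q(β) = L(β⁰) - (2/√(NT)) (β-β⁰)' C + (β-β⁰)' W (β-β⁰)`. -/
def quadObjective (Y : Matrix (Fin N) (Fin T) ℝ) (X : Fin K → Matrix (Fin N) (Fin T) ℝ)
    (lam : Matrix (Fin N) (Fin R) ℝ) (f : Matrix (Fin T) (Fin R) ℝ)
    (e : Matrix (Fin N) (Fin T) ℝ) (β₀ β : EuclideanSpace ℝ (Fin K)) : ℝ :=
  profileObjective R Y X β₀
    - 2 / √((N : ℝ) * T) * ((β - β₀).ofLp ⬝ᵥ (scoreC lam f X e).ofLp)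
    + (β - β₀).ofLp ⬝ᵥ (hessW lam f X *ᵥ (β - β₀).ofLp)

/-- The remainder `R_NT(β)`, defined by `L_NT(β) = L_{q,NT}(β) + (NT)⁻¹ R_NT(β)`. -/
def remainder (Y : Matrix (Fin N) (Fin T) ℝ) (X : Fin K → Matrix (Fin N) (Fin T) ℝ)
    (lam : Matrix (Fin N) (Fin R) ℝ) (f : Matrix (Fin T) (Fin R) ℝ)
    (e : Matrix (Fin N) (Fin T) ℝ) (β₀ β : EuclideanSpace ℝ (Fin K)) : ℝ :=
  (N : ℝ) * T * (profileObjective R Y X β - quadObjective Y X lam f e β₀ β)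

/-! ### Stochastic limits -/

/-- The probability limit of the random matrices `A n` exists (entrywise; it may be random) and is
almost surely positive definite. -/
def PlimPosDef {Ω : Type*} [MeasurableSpace Ω] (P : Measure Ω) {d : ℕ}
    (A : ℕ → Ω → Matrix (Fin d) (Fin d) ℝ) : Prop :=
  ∃ S : Ω → Matrix (Fin d) (Fin d) ℝ,
    (∀ i j, Measurable fun ω => S ω i j) ∧
    (∀ i j, TendstoInMeasure P (fun n ω => A n ω i j) atTop (fun ω => S ω i j)) ∧
    ∀ᵐ ω ∂P, (S ω).PosDef

/-- `Z n = o_p(1)` for nonnegative extended-real-valued functions `Z n`; no measurability of `Z n`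
is presupposed (the outer measure is used). -/
def IsLittleOpOne {Ω : Type*} [MeasurableSpace Ω] (P : Measure Ω) (Z : ℕ → Ω → ℝ≥0∞) : Prop :=
  ∀ ε : ℝ≥0∞, 0 < ε → Tendsto (fun n => P {ω | ε ≤ Z n ω}) atTop (𝓝 0)

/-- With probability approaching one, `E n` holds (the outer probability of failure vanishes). -/
def Wpa1 {Ω : Type*} [MeasurableSpace Ω] (P : Measure Ω) (E : ℕ → Ω → Prop) : Prop :=
  Tendsto (fun n => P {ω | ¬ E n ω}) atTop (𝓝 0)

end PanelIFE

end

/-!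
Write `A(β) = Y - β·X = λ⁰f⁰' + E` with `E = e - (β - β⁰)·X`. The objective `NT·L(β)` is the squared
Frobenius norm of the residual `Z(β)` of the best approximation of `A(β)` by a matrix of rank `R`,
and by the envelope theorem its gradient has the entries `-2 Tr(Xₖ' Z(β))`. The theorem is therefore
a second-order expansion of `Z` in `E`, valid because the nonzero singular values of `λ⁰f⁰'` are of
order `√(NT)`, while `‖E‖ ≤ ‖e‖ + O(√(NT)) ‖β - β⁰‖` is of smaller order.

The expansion is obtained without analytic perturbation theory. By the Eckart-Young-Mirsky theorem
(`exists_best_approx`) the approximation `UV'` is optimal in the Frobenius and in the operator norm,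
so that `‖Z‖ ≤ ‖E‖`, and `U'Z = 0`, `ZV = 0`. These orthogonality relations give the components of
`Z` along the ranges of `λ⁰` and `f⁰`, and the fact that `UV'` has rank `R` gives the remaining one
(`FactorInverse.exists_isResidual`). In the resulting equations `Z` occurs on the right only in
terms of higher order. Subtracting two sets of them shows that `Z` is Lipschitz in `E`
(`IsResidual.norm_sub_le`), which makes the objective differentiable
(`FactorInverse.exists_hasGradientAt_profile`); substituting them into themselves gives
`Z = M_λ E M_f - Q(E, E) + O(‖E‖³ / NT)` with an explicit bilinear `Q`
(`IsResidual.abs_trace_sub_le`).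

The linear term and `Q(e, e)` produce exactly `C⁽¹⁾`, `W` and `C⁽²⁾` (`gradient_remainder_apply`).
What is left is the third-order error and the part of `Q` that involves `β - β⁰`. Both factor
through dimension `R`, so that pairing them with `Xₖ` costs only the Frobenius norm of `Xₖ`, which
is `O(√(NT))`; here `‖e‖³ = o(N²)` is what the assumption on `‖e‖` is needed for
(`exists_norm_gradient_remainder_le`). The assumptions on the probability limits provide uniform
constants outside an event of small probability (`PlimPosDef.exists_lower_bound`,
`PlimPosDef.exists_diag_bound`).
-/

noncomputable section

namespace PanelIFE

/-! ### Operator and Frobenius norms -/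

section Norms

open scoped Matrix.Norms.L2Operator

variable {m n r : ℕ}

theorem norm_toLp_sq (x : Fin n → ℝ) : ‖WithLp.toLp 2 x‖ ^ 2 = x ⬝ᵥ x := by
  rw [EuclideanSpace.real_norm_sq_eq]
  simp [dotProduct, sq]

theorem dotProduct_self_nonneg_real (x : Fin n → ℝ) : 0 ≤ x ⬝ᵥ x :=
  Finset.sum_nonneg fun _ _ => mul_self_nonneg _

theorem mulVec_dotProduct_self_le (A : Matrix (Fin m) (Fin n) ℝ) (x : Fin n → ℝ) :
    (A *ᵥ x) ⬝ᵥ (A *ᵥ x) ≤ ‖A‖ ^ 2 * (x ⬝ᵥ x) := by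
  have h := l2_opNorm_mulVec A (WithLp.toLp 2 x)
  have h2 := pow_le_pow_left₀ (norm_nonneg _) h 2
  rw [mul_pow] at h2
  rwa [← norm_toLp_sq, ← norm_toLp_sq]

theorem opNorm_le_of_mulVec {A : Matrix (Fin m) (Fin n) ℝ} {C : ℝ} (hC : 0 ≤ C)
    (h : ∀ x : Fin n → ℝ, (A *ᵥ x) ⬝ᵥ (A *ᵥ x) ≤ C ^ 2 * (x ⬝ᵥ x)) : ‖A‖ ≤ C := by
  rw [l2_opNorm_def]
  refine ContinuousLinearMap.opNorm_le_bound _ hC fun x => ?_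
  refine le_of_sq_le_sq ?_ (by positivity)
  have := h x.ofLp
  rw [← norm_toLp_sq, ← norm_toLp_sq] at this
  rw [mul_pow]
  exact this

theorem opNorm_transpose (A : Matrix (Fin m) (Fin n) ℝ) : ‖Aᵀ‖ = ‖A‖ := by
  rw [← conjTranspose_eq_transpose_of_trivial, l2_opNorm_conjTranspose]

/-- A symmetric idempotent matrix is a contraction. -/
theorem opNorm_le_one_of_proj {P : Matrix (Fin n) (Fin n) ℝ} (hs : Pᵀ = P) (hi : P * P = P) :
    ‖P‖ ≤ 1 := by
  have h := l2_opNorm_conjTranspose_mul_self P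
  rw [conjTranspose_eq_transpose_of_trivial, hs, hi] at h
  nlinarith [norm_nonneg P]

/-- The Frobenius norm `√(∑ Aᵢⱼ²)`. -/
def frob (A : Matrix (Fin m) (Fin n) ℝ) : ℝ := √(∑ i, ∑ j, A i j ^ 2)

theorem frob_nonneg (A : Matrix (Fin m) (Fin n) ℝ) : 0 ≤ frob A := Real.sqrt_nonneg _

theorem frob_sq (A : Matrix (Fin m) (Fin n) ℝ) : frob A ^ 2 = ∑ i, ∑ j, A i j ^ 2 :=
  Real.sq_sqrt (by positivity)

theorem trace_transpose_mul_eq (A B : Matrix (Fin m) (Fin n) ℝ) :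
    (Aᵀ * B).trace = ∑ i, ∑ j, A i j * B i j := by
  rw [Finset.sum_comm]
  simp [trace, mul_apply]

theorem trace_self_eq_frob_sq (A : Matrix (Fin m) (Fin n) ℝ) : (Aᵀ * A).trace = frob A ^ 2 := by
  rw [trace_transpose_mul_eq, frob_sq]
  simp [sq]

theorem frob_transpose (A : Matrix (Fin m) (Fin n) ℝ) : frob Aᵀ = frob A := by
  unfold frob
  rw [Finset.sum_comm]
  rfl

/-- The Cauchy-Schwarz inequality for the trace inner product. -/
theorem abs_trace_le (A B : Matrix (Fin m) (Fin n) ℝ) : |(Aᵀ * B).trace| ≤ frob A * frob B := by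
  rw [trace_transpose_mul_eq]
  refine abs_le_of_sq_le_sq ?_ (mul_nonneg (frob_nonneg _) (frob_nonneg _))
  rw [mul_pow, frob_sq, frob_sq]
  simp only [← Fintype.sum_prod_type']
  exact Finset.sum_mul_sq_le_sq_mul_sq _ (fun p : Fin m × Fin n => A p.1 p.2) (fun p => B p.1 p.2)

theorem frob_sq_eq_sum_col (A : Matrix (Fin m) (Fin n) ℝ) : frob A ^ 2 = ∑ j, Aᵀ j ⬝ᵥ Aᵀ j := by
  rw [frob_sq, Finset.sum_comm]
  simp [dotProduct, sq]

theorem frob_mul_le (A : Matrix (Fin m) (Fin n) ℝ) (B : Matrix (Fin n) (Fin r) ℝ) :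
    frob (A * B) ≤ ‖A‖ * frob B := by
  refine le_of_sq_le_sq ?_ (mul_nonneg (norm_nonneg _) (frob_nonneg _))
  rw [mul_pow, frob_sq_eq_sum_col, frob_sq_eq_sum_col, Finset.mul_sum]
  refine Finset.sum_le_sum fun j _ => ?_
  exact mulVec_dotProduct_self_le A (Bᵀ j)

theorem frob_le_sqrt_card_mul (A : Matrix (Fin m) (Fin n) ℝ) : frob A ≤ √n * ‖A‖ := by
  have h := frob_mul_le A (1 : Matrix (Fin n) (Fin n) ℝ)
  have h1 : frob (1 : Matrix (Fin n) (Fin n) ℝ) = √n := by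
    unfold frob
    congr 1
    simp [one_apply]
  rwa [Matrix.mul_one, h1, mul_comm] at h

theorem opNorm_le_frob (A : Matrix (Fin m) (Fin n) ℝ) : ‖A‖ ≤ frob A := by
  refine opNorm_le_of_mulVec (frob_nonneg _) fun x => ?_
  rw [frob_sq, Finset.sum_mul]
  refine Finset.sum_le_sum fun i _ => ?_
  have := Finset.sum_mul_sq_le_sq_mul_sq Finset.univ (fun j => A i j) x
  simpa [mulVec, dotProduct, sq] using this

/-- A product with inner dimension `r` pairs with `X` through the operator norms of its factors, at
the price of the factor `√r`. -/
theorem abs_trace_mul_mul_le (X : Matrix (Fin m) (Fin n) ℝ) (U : Matrix (Fin m) (Fin r) ℝ)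
    (V : Matrix (Fin r) (Fin n) ℝ) :
    |(Xᵀ * (U * V)).trace| ≤ √r * frob X * (‖U‖ * ‖V‖) := by
  have h1 := abs_trace_le X (U * V)
  have h2 := frob_mul_le U V
  have h3 := frob_le_sqrt_card_mul Vᵀ
  rw [frob_transpose, opNorm_transpose] at h3
  calc _ ≤ frob X * (‖U‖ * (√r * ‖V‖)) :=
        h1.trans (mul_le_mul_of_nonneg_left
          (h2.trans (mul_le_mul_of_nonneg_left h3 (norm_nonneg _))) (frob_nonneg _))
    _ = _ := by ring

end Norms

/-! ### Best low-rank approximation -/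

section LowRank

open scoped Matrix.Norms.L2Operator

theorem mulVec_dotProduct_mulVec {k m n : ℕ} (A : Matrix (Fin k) (Fin m) ℝ)
    (B : Matrix (Fin k) (Fin n) ℝ) (x : Fin m → ℝ) (y : Fin n → ℝ) :
    (A *ᵥ x) ⬝ᵥ (B *ᵥ y) = x ⬝ᵥ ((Aᵀ * B) *ᵥ y) := by
  rw [← mulVec_mulVec, dotProduct_mulVec x, vecMul_transpose]

/-- The spectral decomposition of a positive semidefinite matrix, eigenvalues in decreasing
order. -/
theorem exists_antitone_spectral {n : ℕ} {G : Matrix (Fin n) (Fin n) ℝ} (hG : G.PosSemidef) :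
    ∃ (W : Matrix (Fin n) (Fin n) ℝ) (μ : Fin n → ℝ), Wᵀ * W = 1 ∧ W * Wᵀ = 1 ∧ Antitone μ ∧
      (∀ i, 0 ≤ μ i) ∧ G = W * diagonal μ * Wᵀ := by
  have hH := hG.isHermitian
  set U := (hH.eigenvectorUnitary : Matrix (Fin n) (Fin n) ℝ) with hU
  have hUU : Uᵀ * U = 1 := by
    have := Unitary.coe_star_mul_self hH.eigenvectorUnitary
    rwa [star_eq_conjTranspose, conjTranspose_eq_transpose_of_trivial] at this
  have hspec : G = U * diagonal hH.eigenvalues * Uᵀ := by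
    have h : G = U * diagonal hH.eigenvalues * star U := hH.spectral_theorem
    rwa [star_eq_conjTranspose, conjTranspose_eq_transpose_of_trivial] at h
  set σ := Tuple.sort fun i => -hH.eigenvalues i with hσ
  refine ⟨U.submatrix id σ, hH.eigenvalues ∘ σ, ?_, ?_, ?_, ?_, ?_⟩
  · have := submatrix_mul_equiv Uᵀ U σ (Equiv.refl _) σ
    rw [hUU, submatrix_one_equiv] at this
    exact this
  · rw [transpose_submatrix, submatrix_mul_equiv, mul_eq_one_comm.1 hUU]
    simp
  · intro i j hij
    have := Tuple.monotone_sort (fun i => -hH.eigenvalues i) hij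
    simpa using this
  · exact fun i => hG.eigenvalues_nonneg _
  · have : diagonal (hH.eigenvalues ∘ σ) = (diagonal hH.eigenvalues).submatrix σ σ := by
      ext i j; simp [diagonal_apply]
    rw [this, transpose_submatrix, submatrix_mul_equiv, submatrix_mul_equiv, ← hspec]
    simp

/-- Ky Fan's bound: weights `0 ≤ w ≤ 1` of total mass at most `R` pick up at most the `R` largest
entries. -/
theorem sum_mul_le_sum_top {n : ℕ} (R : ℕ) {μ w : Fin n → ℝ} (hμ : Antitone μ)
    (h0 : ∀ i, 0 ≤ μ i) (hw0 : ∀ i, 0 ≤ w i) (hw1 : ∀ i, w i ≤ 1) (hw : ∑ i, w i ≤ R) :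
    ∑ i, w i * μ i ≤ ∑ i, (if i.val < R then 1 else 0) * μ i := by
  by_cases hR : R < n
  · set t := μ ⟨R, hR⟩
    have h1 : ∑ i : Fin n, (if i.val < R then (1 : ℝ) else 0) = R := by
      rw [Finset.sum_ite, Finset.sum_const_zero, add_zero, Finset.sum_const, nsmul_eq_mul, mul_one]
      norm_cast
      have : (Finset.univ.filter fun i : Fin n => i.val < R) = Finset.Iio ⟨R, hR⟩ := by
        ext i; simp [Fin.lt_def]
      rw [this]; simp
    have h2 : ∑ i, ((if i.val < R then (1 : ℝ) else 0) - w i) * t ≤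
        ∑ i, ((if i.val < R then (1 : ℝ) else 0) - w i) * μ i := by
      refine Finset.sum_le_sum fun i _ => ?_
      split_ifs with h
      · exact mul_le_mul_of_nonneg_left (hμ (Fin.le_def.2 h.le)) (by linarith [hw1 i])
      · have : μ i ≤ t := hμ (Fin.le_def.2 (not_lt.1 h))
        nlinarith [hw0 i]
    rw [← Finset.sum_mul, Finset.sum_sub_distrib, h1] at h2
    have h3 : 0 ≤ (R - ∑ i, w i) * t := mul_nonneg (by linarith) (h0 _)
    simp only [sub_mul, Finset.sum_sub_distrib] at h2
    linarith [sub_mul (R : ℝ) (∑ i, w i) t]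
  · refine Finset.sum_le_sum fun i _ => ?_
    rw [if_pos (i.2.trans_le (not_lt.1 hR))]
    exact mul_le_mul_of_nonneg_right (hw1 i) (h0 i)

theorem symmPinv_transpose {n : ℕ} {G : Matrix (Fin n) (Fin n) ℝ} (hG : G.IsHermitian) :
    (symmPinv hG)ᵀ = symmPinv hG := by
  unfold symmPinv
  rw [star_eq_conjTranspose, conjTranspose_eq_transpose_of_trivial]
  simp [transpose_mul, Matrix.mul_assoc]

variable {m n R : ℕ}

theorem annih_transpose (A : Matrix (Fin m) (Fin n) ℝ) : (annih A)ᵀ = annih A := by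
  unfold annih
  simp [transpose_sub, transpose_mul, symmPinv_transpose, Matrix.mul_assoc]

theorem annih_mul_self (A : Matrix (Fin m) (Fin n) ℝ) : annih A * A = 0 := by
  obtain ⟨h1, -, h3, h4⟩ := symmPinv_penrose (gram_isHermitian A)
  set H := symmPinv (gram_isHermitian A)
  have hH : Hᵀ = H := symmPinv_transpose _
  -- `A (1 - H A'A)` vanishes because its Gram matrix does
  have : (A - A * H * (Aᵀ * A))ᵀ * (A - A * H * (Aᵀ * A)) = 0 := by
    have e1 : (A - A * H * (Aᵀ * A))ᵀ * (A - A * H * (Aᵀ * A)) =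
        (1 - (Aᵀ * A) * H) * ((Aᵀ * A) - (Aᵀ * A) * H * (Aᵀ * A)) := by
      simp only [transpose_sub, transpose_mul, transpose_transpose, hH, Matrix.sub_mul,
        Matrix.mul_sub, Matrix.one_mul, Matrix.mul_assoc]
    rw [e1, h1, sub_self, Matrix.mul_zero]
  rw [← conjTranspose_eq_transpose_of_trivial, conjTranspose_mul_self_eq_zero] at this
  rw [annih, Matrix.sub_mul, Matrix.one_mul, Matrix.mul_assoc (A * _)]
  exact this

theorem annih_idem (A : Matrix (Fin m) (Fin n) ℝ) : annih A * annih A = annih A := by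
  nth_rw 2 [annih]
  rw [Matrix.mul_sub, Matrix.mul_one, ← Matrix.mul_assoc, ← Matrix.mul_assoc, annih_mul_self]
  simp

/-- The projection onto the range of a matrix with `n` columns has trace at most `n`. -/
theorem trace_one_sub_annih_le (A : Matrix (Fin m) (Fin n) ℝ) : (1 - annih A).trace ≤ n := by
  obtain ⟨h1, h2, h3, h4⟩ := symmPinv_penrose (gram_isHermitian A)
  set H := symmPinv (gram_isHermitian A) with hHdef
  have e1 : (1 - annih A).trace = (H * (Aᵀ * A)).trace := by
    rw [annih, sub_sub_cancel, trace_mul_comm, ← Matrix.mul_assoc, trace_mul_comm]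
  have e2 : (1 - H * (Aᵀ * A))ᵀ * (1 - H * (Aᵀ * A)) = 1 - H * (Aᵀ * A) := by
    rw [transpose_sub, h4, transpose_one, Matrix.mul_sub, Matrix.sub_mul, Matrix.sub_mul,
      ← Matrix.mul_assoc (H * (Aᵀ * A)) H, h2]
    simp
  have e3 := trace_self_eq_frob_sq (1 - H * (Aᵀ * A))
  rw [e2, trace_sub, trace_one, Fintype.card_fin] at e3
  nlinarith [sq_nonneg (frob (1 - H * (Aᵀ * A)))]

theorem diag_conj_proj_nonneg {W : Matrix (Fin m) (Fin m) ℝ} {P : Matrix (Fin m) (Fin m) ℝ}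
    (hP : Pᵀ = P) (hPP : P * P = P) (i : Fin m) : 0 ≤ (Wᵀ * P * W) i i := by
  have : Wᵀ * P * W = (P * W)ᵀ * (P * W) := by
    rw [transpose_mul, hP, Matrix.mul_assoc, Matrix.mul_assoc, ← Matrix.mul_assoc P P, hPP]
  rw [this, mul_apply]
  exact Finset.sum_nonneg fun j _ => mul_self_nonneg _

/-- The Eckart-Young-Mirsky theorem: some product `U V'` with inner dimension `R` is the best such
approximation of `A` simultaneously in the Frobenius and in the operator norm, and its residual is
orthogonal to its columns and rows. -/
theorem exists_best_approx (R : ℕ) (A : Matrix (Fin m) (Fin n) ℝ) :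
    ∃ (U : Matrix (Fin m) (Fin R) ℝ) (V : Matrix (Fin n) (Fin R) ℝ),
      Uᵀ * (A - U * Vᵀ) = 0 ∧ (A - U * Vᵀ) * V = 0 ∧
      ∀ (B : Matrix (Fin m) (Fin R) ℝ) (C : Matrix (Fin n) (Fin R) ℝ),
        frob (A - U * Vᵀ) ^ 2 ≤ frob (A - B * Cᵀ) ^ 2 ∧ ‖A - U * Vᵀ‖ ≤ ‖A - B * Cᵀ‖ := by
  have hpsd : (A * Aᵀ).PosSemidef := by
    rw [← conjTranspose_eq_transpose_of_trivial]; exact posSemidef_self_mul_conjTranspose A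
  obtain ⟨W, μ, hW1, hW2, hanti, hμ0, hspec⟩ := exists_antitone_spectral hpsd
  -- `J` selects the first `R` eigenvectors
  set J : Matrix (Fin m) (Fin R) ℝ := Matrix.of fun i r => if i.val = r.val then 1 else 0 with hJ
  set d : Fin m → ℝ := fun i => if i.val < R then 1 else 0 with hd
  have hJJ : J * Jᵀ = diagonal d := by
    ext i j
    simp only [mul_apply, hJ, transpose_apply, of_apply, diagonal_apply, hd]
    by_cases hi : i.val < R
    · rw [Finset.sum_eq_single ⟨i.val, hi⟩]
      · simp [hi, Fin.ext_iff, eq_comm]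
      · intro r _ hr
        have : ¬ (i.val = r.val) := fun h => hr (Fin.ext h.symm)
        simp [this]
      · simp
    · rw [Finset.sum_eq_zero]
      · simp [hi]
      · intro r _
        have : ¬ (i.val = r.val) := fun h => hi (h ▸ r.2)
        simp [this]
  have hdJ : diagonal (1 - d) * J = 0 := by
    ext i r
    by_cases h : i.val = r.val
    · simp [hd, h]
    · simp [hJ, h]
  have hJd : Jᵀ * diagonal (1 - d) = 0 := by
    have := congrArg transpose hdJ
    simpa [transpose_mul] using this
  have h1d : (1 : Matrix (Fin m) (Fin m) ℝ) - diagonal d = diagonal (1 - d) := by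
    rw [← diagonal_one, diagonal_sub]; rfl
  have hUV : A - (W * J) * (Aᵀ * (W * J))ᵀ = W * diagonal (1 - d) * Wᵀ * A := by
    rw [← h1d, Matrix.mul_sub, Matrix.sub_mul, Matrix.sub_mul, Matrix.mul_one, hW2, ← hJJ]
    simp [transpose_mul, Matrix.mul_assoc]
  refine ⟨W * J, Aᵀ * (W * J), ?_, ?_, fun B C => ?_⟩ <;> rw [hUV]
  · have : (W * J)ᵀ * (W * diagonal (1 - d) * Wᵀ * A) =
        Jᵀ * ((Wᵀ * W) * diagonal (1 - d)) * Wᵀ * A := by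
      simp only [transpose_mul, Matrix.mul_assoc]
    rw [this, hW1, Matrix.one_mul, hJd]
    simp
  · have : W * diagonal (1 - d) * Wᵀ * A * (Aᵀ * (W * J)) =
        W * diagonal (1 - d) * (Wᵀ * W) * diagonal μ * (Wᵀ * W) * J := by
      have : W * diagonal (1 - d) * Wᵀ * A * (Aᵀ * (W * J)) =
        W * diagonal (1 - d) * Wᵀ * (A * Aᵀ) * (W * J) := by simp only [Matrix.mul_assoc]
      rw [this, hspec]; simp only [Matrix.mul_assoc]
    rw [this, hW1, Matrix.mul_one, Matrix.mul_one, Matrix.mul_assoc W, diagonal_mul_diagonal']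
    rw [show (diagonal fun i => (1 - d) i * μ i) = diagonal μ * diagonal (1 - d) by
        rw [diagonal_mul_diagonal]; simp only [mul_comm],
      Matrix.mul_assoc, Matrix.mul_assoc, hdJ]
    simp
  · -- the Gram matrix of the residual
    set Z := W * diagonal (1 - d) * Wᵀ * A with hZ
    have hZZ : Z * Zᵀ = W * diagonal ((1 - d) * μ) * Wᵀ := by
      have e : Z * Zᵀ = W * diagonal (1 - d) * Wᵀ * (A * Aᵀ) * (W * diagonal (1 - d) * Wᵀ) := by
        rw [hZ]; simp [transpose_mul, Matrix.mul_assoc]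
      have e2 : W * diagonal (1 - d) * Wᵀ * (W * diagonal μ * Wᵀ) * (W * diagonal (1 - d) * Wᵀ) =
          W * diagonal (1 - d) * (Wᵀ * W) * diagonal μ * (Wᵀ * W) * diagonal (1 - d) * Wᵀ := by
        simp only [Matrix.mul_assoc]
      rw [e, hspec, e2, hW1, Matrix.mul_one, Matrix.mul_one, Matrix.mul_assoc W,
        diagonal_mul_diagonal', Matrix.mul_assoc W, diagonal_mul_diagonal']
      congr 3
      ext i
      simp only [hd, Pi.mul_apply, Pi.sub_apply, Pi.one_apply]
      split_ifs <;> ring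
    constructor
    · -- Frobenius norm: Ky Fan's bound for the diagonal of the projection onto the range of `B`
      have hM := annih_idem B
      have hMt := annih_transpose B
      set M := annih B with hMdef
      have hPt : (1 - M)ᵀ = 1 - M := by rw [transpose_sub, hMt, transpose_one]
      have hPP : (1 - M) * (1 - M) = 1 - M := by
        rw [Matrix.mul_sub, Matrix.sub_mul, Matrix.sub_mul, hM]; simp
      have hres : frob (M * A) ^ 2 ≤ frob (A - B * Cᵀ) ^ 2 := by
        have e : M * A = M * (A - B * Cᵀ) := by
          rw [Matrix.mul_sub, ← Matrix.mul_assoc, annih_mul_self]; simp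
        rw [e]
        refine pow_le_pow_left₀ (frob_nonneg _) ((frob_mul_le _ _).trans ?_) 2
        exact mul_le_of_le_one_left (frob_nonneg _) (opNorm_le_one_of_proj hMt hM)
      refine le_trans ?_ hres
      have etr : ∀ (S : Matrix (Fin m) (Fin m) ℝ), (S * (A * Aᵀ)).trace =
          ∑ i, (Wᵀ * S * W) i i * μ i := by
        intro S
        have : (S * (A * Aᵀ)).trace = (Wᵀ * S * W * diagonal μ).trace := by
          rw [hspec, ← Matrix.mul_assoc, trace_mul_comm]
          simp only [Matrix.mul_assoc]
        rw [this]
        simp [trace, mul_diagonal]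
      have eM : frob (M * A) ^ 2 = (A * Aᵀ).trace - ∑ i, (Wᵀ * (1 - M) * W) i i * μ i := by
        rw [← etr, ← trace_self_eq_frob_sq, transpose_mul, hMt, Matrix.mul_assoc,
          ← Matrix.mul_assoc M M, hM, trace_mul_comm, Matrix.mul_assoc, Matrix.sub_mul, trace_sub,
          Matrix.one_mul]
        ring
      have eZ : frob Z ^ 2 = (A * Aᵀ).trace - ∑ i, d i * μ i := by
        have e1 : (A * Aᵀ).trace = ∑ i, μ i := by
          rw [hspec, trace_mul_comm, ← Matrix.mul_assoc, hW1]; simp [trace]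
        rw [← frob_transpose, ← trace_self_eq_frob_sq, transpose_transpose, hZZ, trace_mul_comm,
          ← Matrix.mul_assoc, hW1, e1]
        simp [trace, sub_mul, Finset.sum_sub_distrib]
      rw [eZ, eM]
      refine sub_le_sub_left (sum_mul_le_sum_top R hanti hμ0
        (fun i => diag_conj_proj_nonneg hPt hPP i)
        (fun i => ?_) ?_) _
      · have h1 := diag_conj_proj_nonneg (W := W) hMt hM i
        have h2 : Wᵀ * (1 - M) * W = 1 - Wᵀ * M * W := by
          rw [Matrix.mul_sub, Matrix.sub_mul, Matrix.mul_one, hW1]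
        rw [h2, Matrix.sub_apply, one_apply_eq]
        linarith
      · have h2 := trace_one_sub_annih_le B
        rw [← hMdef] at h2
        have h3 : (Wᵀ * (1 - M) * W).trace = (1 - M).trace := by
          rw [trace_mul_comm, ← Matrix.mul_assoc, hW2, Matrix.one_mul]
        rw [← h3] at h2
        exact h2
    · -- operator norm: a combination of the first `R + 1` eigenvectors is orthogonal to `B`
      set ρ := ‖A - B * Cᵀ‖
      have hρ : 0 ≤ ρ := norm_nonneg _
      have hμR : ∀ i : Fin m, R ≤ i.val → μ i ≤ ρ ^ 2 := by
        intro i hi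
        have hRm : R + 1 ≤ m := by omega
        set J' : Matrix (Fin m) (Fin (R + 1)) ℝ := (1 : Matrix (Fin m) (Fin m) ℝ).submatrix id
          (Fin.castLE hRm) with hJ'
        have hker : LinearMap.ker (Matrix.mulVecLin (Bᵀ * W * J')) ≠ ⊥ :=
          LinearMap.ker_ne_bot_of_finrank_lt (by simp)
        obtain ⟨c, hc, hc0⟩ := (Submodule.ne_bot_iff _).1 hker
        obtain ⟨v, hv⟩ : ∃ v, v = J' *ᵥ c := ⟨_, rfl⟩
        have hc1 : Bᵀ *ᵥ (W *ᵥ v) = 0 := by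
          rw [LinearMap.mem_ker, mulVecLin_apply] at hc
          rw [hv, mulVec_mulVec, mulVec_mulVec, hc]
        have hvc : ∀ k : Fin (R + 1), v (Fin.castLE hRm k) = c k := by
          intro k
          simp [hv, hJ', mulVec, dotProduct, one_apply]
        have hv0 : ∀ j : Fin m, R < j.val → v j = 0 := by
          intro j hj
          simp only [hv, hJ', mulVec, dotProduct, submatrix_apply, id, one_apply]
          refine Finset.sum_eq_zero fun k _ => ?_
          have : j ≠ Fin.castLE hRm k := by
            intro h; rw [h] at hj; simp at hj; omega
          simp [this]
        have hvpos : 0 < v ⬝ᵥ v := by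
          have h0 : 0 ≤ v ⬝ᵥ v := dotProduct_self_nonneg_real v
          refine lt_of_le_of_ne h0 fun h => hc0 ?_
          have := dotProduct_self_eq_zero.1 h.symm
          ext k
          rw [← hvc, this]; rfl
        have hWv : (W *ᵥ v) ⬝ᵥ (W *ᵥ v) = v ⬝ᵥ v := by
          rw [mulVec_dotProduct_mulVec, hW1, one_mulVec]
        have h1 := mulVec_dotProduct_self_le (A - B * Cᵀ)ᵀ (W *ᵥ v)
        rw [opNorm_transpose, hWv] at h1
        have h2 : (A - B * Cᵀ)ᵀ *ᵥ (W *ᵥ v) = Aᵀ *ᵥ (W *ᵥ v) := by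
          rw [transpose_sub, transpose_mul, transpose_transpose, sub_mulVec,
            ← mulVec_mulVec _ C, hc1]
          simp
        have h3 : (Aᵀ *ᵥ (W *ᵥ v)) ⬝ᵥ (Aᵀ *ᵥ (W *ᵥ v)) = ∑ j, μ j * (v j * v j) := by
          have e : Wᵀ * (W * diagonal μ * Wᵀ * W) = (Wᵀ * W) * diagonal μ * (Wᵀ * W) := by
            simp only [Matrix.mul_assoc]
          rw [mulVec_dotProduct_mulVec, transpose_transpose, hspec, mulVec_mulVec,
            mulVec_dotProduct_mulVec, e, hW1, Matrix.one_mul, Matrix.mul_one]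
          simp only [dotProduct, mulVec_diagonal]
          exact Finset.sum_congr rfl fun j _ => by ring
        rw [h2, h3] at h1
        have h4 : μ i * (v ⬝ᵥ v) ≤ ∑ j, μ j * (v j * v j) := by
          rw [dotProduct, Finset.mul_sum]
          refine Finset.sum_le_sum fun j _ => ?_
          by_cases hj : R < j.val
          · simp [hv0 j hj]
          · exact mul_le_mul_of_nonneg_right (hanti (Fin.le_def.2 (by omega)))
              (mul_self_nonneg _)
        exact le_of_mul_le_mul_right (h4.trans h1) hvpos
      rw [← opNorm_transpose]
      refine opNorm_le_of_mulVec hρ fun x => ?_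
      set y := Wᵀ *ᵥ x with hy
      have hyx : y ⬝ᵥ y = x ⬝ᵥ x := by
        rw [hy, mulVec_dotProduct_mulVec, transpose_transpose, hW2, one_mulVec]
      have h1 : (Zᵀ *ᵥ x) ⬝ᵥ (Zᵀ *ᵥ x) = ∑ j, (1 - d j) * μ j * (y j * y j) := by
        rw [mulVec_dotProduct_mulVec, transpose_transpose, hZZ, Matrix.mul_assoc,
          ← transpose_transpose W, ← mulVec_dotProduct_mulVec, transpose_transpose,
          ← mulVec_mulVec, ← hy]
        simp only [dotProduct, mulVec_diagonal]
        exact Finset.sum_congr rfl fun j _ => by simp; ring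
      rw [h1, ← hyx, dotProduct, Finset.mul_sum]
      refine Finset.sum_le_sum fun j _ => mul_le_mul_of_nonneg_right ?_ (mul_self_nonneg _)
      simp only [hd]
      split_ifs with h
      · simpa using sq_nonneg ρ
      · simpa using hμR j (not_lt.1 h)

end LowRank

/-! ### Perturbation of the least squares residual -/

section Perturbation

open scoped Matrix.Norms.L2Operator

variable {N T R : ℕ} {lam : Matrix (Fin N) (Fin R) ℝ} {f : Matrix (Fin T) (Fin R) ℝ}
  {Lam : Matrix (Fin R) (Fin N) ℝ} {F : Matrix (Fin T) (Fin R) ℝ}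

/-- `Lam` and `F'` are the Moore-Penrose left inverses of the loadings `lam` and of the
factors `f`, i.e. `Lam = (λ'λ)⁻¹λ'` and `F = f(f'f)⁻¹`. The last two conditions single them out
among all left inverses: they make `λ Lam` and `f F'` the orthogonal projections. -/
structure FactorInverse (lam : Matrix (Fin N) (Fin R) ℝ) (f : Matrix (Fin T) (Fin R) ℝ)
    (Lam : Matrix (Fin R) (Fin N) ℝ) (F : Matrix (Fin T) (Fin R) ℝ) : Prop where
  lam_inv : Lam * lam = 1
  f_inv : Fᵀ * f = 1
  annih_lam : annih lam = 1 - lam * Lam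
  annih_f : annih f = 1 - f * Fᵀ

/-- The equations satisfied by the residual `Z` of the best approximation of `λf' + E` by a
matrix of rank `R`. The approximation is `λf' + D` with `D = E - Z`, and the `N × R` matrix `Xi`
expresses the part of its rows outside the range of `λ` through the part inside. -/
structure IsResidual (lam : Matrix (Fin N) (Fin R) ℝ) (f : Matrix (Fin T) (Fin R) ℝ)
    (Lam : Matrix (Fin R) (Fin N) ℝ) (F : Matrix (Fin T) (Fin R) ℝ)
    (E Z D : Matrix (Fin N) (Fin T) ℝ) (Xi : Matrix (Fin N) (Fin R) ℝ) : Prop where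
  diff : D = E - Z
  lam_mul : Lam * Z = -(Lam * (Lamᵀ * (Fᵀ * (Dᵀ * Z))))
  mul_f : Z * F = -(Z * (Dᵀ * (Lamᵀ * (Fᵀ * F))))
  main : Z = annih lam * (E * annih f) - Z * (Dᵀ * (Lamᵀ * Fᵀ))
    - Lamᵀ * (Fᵀ * (Dᵀ * (Z * annih f))) - Xi * (Lam * (D * annih f))
  slope : Xi = annih lam * (D * F) - Xi * (Lam * (D * F))

/-- The residual equations follow from orthogonality and from the rank of the approximation `UV'`:
since `Lam U V' F = 1 + Lam D F` is invertible, so is `Lam U`, and the slope is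
`Xi = M_λ U (Lam U)⁻¹`. -/
theorem FactorInverse.exists_isResidual (h : FactorInverse lam f Lam F)
    {U : Matrix (Fin N) (Fin R) ℝ} {V : Matrix (Fin T) (Fin R) ℝ}
    {E Z : Matrix (Fin N) (Fin T) ℝ} (hZ : Z = lam * fᵀ + E - U * Vᵀ)
    (hU : Uᵀ * Z = 0) (hV : Z * V = 0) (hsmall : ‖Lam * ((E - Z) * F)‖ < 1) :
    ∃ Xi, IsResidual lam f Lam F E Z (E - Z) Xi := by
  obtain ⟨D, hD⟩ : ∃ D, D = E - Z := ⟨_, rfl⟩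
  rw [← hD] at hsmall ⊢
  have hUV : U * Vᵀ = lam * fᵀ + D := by rw [hD, hZ]; abel
  have hP : (lam * Lam)ᵀ = lam * Lam := by
    have := annih_transpose lam
    rw [h.annih_lam, transpose_sub, transpose_one] at this
    exact sub_right_injective this
  have hQ : (f * Fᵀ)ᵀ = f * Fᵀ := by
    have := annih_transpose f
    rw [h.annih_f, transpose_sub, transpose_one] at this
    exact sub_right_injective this
  have hfF : fᵀ * F = 1 := by
    have := congrArg transpose h.f_inv
    simpa [transpose_mul] using this
  have hlL : lamᵀ * Lamᵀ = 1 := by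
    have := congrArg transpose h.lam_inv
    simpa [transpose_mul] using this
  have hF : f * (Fᵀ * F) = F := by
    rw [← Matrix.mul_assoc, ← hQ, transpose_mul, transpose_transpose, Matrix.mul_assoc, hfF,
      Matrix.mul_one]
  have hfM : fᵀ * annih f = 0 := by
    have := congrArg transpose (annih_mul_self f)
    simpa [transpose_mul, annih_transpose] using this
  -- orthogonality of the residual to the fitted columns and rows
  have e1 : lam * (Lam * Z) = -(Lamᵀ * (Fᵀ * (Dᵀ * Z))) := by
    have h0 : (lam * fᵀ + D)ᵀ * Z = 0 := by
      rw [← hUV, transpose_mul, Matrix.mul_assoc, hU, Matrix.mul_zero]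
    rw [transpose_add, transpose_mul, transpose_transpose, Matrix.add_mul] at h0
    have h1 : Dᵀ * Z = -(f * lamᵀ * Z) := (neg_eq_of_add_eq_zero_right h0).symm
    rw [h1, Matrix.mul_neg, Matrix.mul_neg, neg_neg, ← Matrix.mul_assoc, ← hP, transpose_mul,
      Matrix.mul_assoc f, ← Matrix.mul_assoc Fᵀ, h.f_inv, Matrix.one_mul, Matrix.mul_assoc]
  have e2 : Z * (f * Fᵀ) = -(Z * (Dᵀ * (Lamᵀ * Fᵀ))) := by
    have h0 : Z * (lam * fᵀ + D)ᵀ = 0 := by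
      rw [← hUV, transpose_mul, transpose_transpose, ← Matrix.mul_assoc, hV, Matrix.zero_mul]
    rw [transpose_add, transpose_mul, transpose_transpose, Matrix.mul_add] at h0
    have h1 : Z * Dᵀ = -(Z * (f * lamᵀ)) := (neg_eq_of_add_eq_zero_right h0).symm
    rw [← Matrix.mul_assoc Z Dᵀ, h1, Matrix.neg_mul, neg_neg, Matrix.mul_assoc, Matrix.mul_assoc f,
      ← Matrix.mul_assoc lamᵀ, hlL, Matrix.one_mul]
  -- the fitted matrix has rank `R` also after compression to the ranges of `lam` and `f`
  have hS : (Lam * U) * (Vᵀ * F) = 1 + Lam * (D * F) := by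
    have : (Lam * U) * (Vᵀ * F) = Lam * ((U * Vᵀ) * F) := by simp only [Matrix.mul_assoc]
    rw [this, hUV, Matrix.add_mul, Matrix.mul_add, Matrix.mul_assoc, hfF, Matrix.mul_one,
      h.lam_inv]
  have hunit : IsUnit (Lam * U).det := by
    have h1 : IsUnit (1 + Lam * (D * F)) := by
      have := isUnit_one_sub_of_norm_lt_one (x := -(Lam * (D * F))) (by rwa [norm_neg])
      rwa [sub_neg_eq_add] at this
    rw [← hS, isUnit_iff_isUnit_det, det_mul] at h1
    exact isUnit_of_mul_isUnit_left h1
  have e3 : annih lam * D = annih lam * U * (Lam * U)⁻¹ * fᵀ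
      + annih lam * U * (Lam * U)⁻¹ * (Lam * D) := by
    have h1 : annih lam * D = annih lam * (U * Vᵀ) := by
      rw [hUV, Matrix.mul_add, ← Matrix.mul_assoc, annih_mul_self, Matrix.zero_mul, zero_add]
    have h2 : annih lam * (U * Vᵀ) = annih lam * U * (Lam * U)⁻¹ * (Lam * (U * Vᵀ)) := by
      rw [← Matrix.mul_assoc Lam, Matrix.mul_assoc _ (Lam * U)⁻¹, ← Matrix.mul_assoc (Lam * U)⁻¹,
        nonsing_inv_mul _ hunit, Matrix.one_mul, Matrix.mul_assoc]
    rw [h1, h2, hUV, Matrix.mul_add, Matrix.mul_add, ← Matrix.mul_assoc Lam lam, h.lam_inv,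
      Matrix.one_mul]
  obtain ⟨Xi, hXi⟩ : ∃ Xi, Xi = annih lam * U * (Lam * U)⁻¹ := ⟨_, rfl⟩
  rw [← hXi] at e3
  refine ⟨Xi, hD, ?_, ?_, ?_, ?_⟩
  · rw [← Matrix.mul_neg, ← e1, ← Matrix.mul_assoc, h.lam_inv, Matrix.one_mul]
  · have := congrArg (· * F) e2
    simp only [Matrix.neg_mul, Matrix.mul_assoc] at this
    rwa [hF] at this
  · have h1 : Z = Z * (f * Fᵀ) + lam * (Lam * Z) * annih f
        + (annih lam * (E * annih f) - annih lam * D * annih f) := by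
      rw [hD, Matrix.mul_sub, Matrix.sub_mul, ← Matrix.mul_assoc (annih lam) E, sub_sub_cancel,
        ← Matrix.mul_assoc lam, add_assoc, ← Matrix.add_mul, ← Matrix.add_mul, h.annih_lam,
        add_sub_cancel, Matrix.one_mul, ← Matrix.mul_add, h.annih_f, add_sub_cancel,
        Matrix.mul_one]
    rw [e1, e2, e3, Matrix.add_mul, Matrix.mul_assoc Xi, hfM, Matrix.mul_zero, zero_add] at h1
    conv_lhs => rw [h1]
    simp only [Matrix.neg_mul, Matrix.mul_assoc]
    abel
  · rw [← Matrix.mul_assoc, e3, Matrix.add_mul, Matrix.mul_assoc Xi, hfF, Matrix.mul_one,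
      ← Matrix.mul_assoc Lam, Matrix.mul_assoc Xi, add_sub_cancel_right]

theorem opNorm_mul_le_of_le {m n r : ℕ} {A : Matrix (Fin m) (Fin n) ℝ}
    {B : Matrix (Fin n) (Fin r) ℝ} {a b : ℝ} (hA : ‖A‖ ≤ a) (hB : ‖B‖ ≤ b) : ‖A * B‖ ≤ a * b :=
  (l2_opNorm_mul A B).trans (mul_le_mul hA hB (norm_nonneg _) ((norm_nonneg _).trans hA))

theorem opNorm_transpose_le {m n : ℕ} {A : Matrix (Fin m) (Fin n) ℝ} {a : ℝ} (hA : ‖A‖ ≤ a) :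
    ‖Aᵀ‖ ≤ a := (opNorm_transpose A).le.trans hA

theorem opNorm_annih_le {m n : ℕ} (A : Matrix (Fin m) (Fin n) ℝ) : ‖annih A‖ ≤ 1 :=
  opNorm_le_one_of_proj (annih_transpose A) (annih_idem A)

variable {E Z D E₁ Z₁ D₁ E₂ Z₂ D₂ : Matrix (Fin N) (Fin T) ℝ}
  {Xi Xi₁ Xi₂ : Matrix (Fin N) (Fin R) ℝ} {l p ε : ℝ}

theorem IsResidual.norm_diff_le (h : IsResidual lam f Lam F E Z D Xi) (hE : ‖E‖ ≤ ε)
    (hZ : ‖Z‖ ≤ ε) : ‖D‖ ≤ 2 * ε := by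
  rw [h.diff]
  linarith [norm_sub_le E Z]

theorem IsResidual.norm_slope_le (h : IsResidual lam f Lam F E Z D Xi) (hL : ‖Lam‖ ≤ l)
    (hF : ‖F‖ ≤ p) (hE : ‖E‖ ≤ ε) (hZ : ‖Z‖ ≤ ε) (hs : 4 * (l * p * ε) ≤ 1) :
    ‖Xi‖ ≤ 4 * (p * ε) := by
  have hD := h.norm_diff_le hE hZ
  have hM := opNorm_annih_le lam
  have h1 : ‖annih lam * (D * F)‖ ≤ 1 * (2 * ε * p) :=
    opNorm_mul_le_of_le hM (opNorm_mul_le_of_le hD hF)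
  have h2 : ‖Xi * (Lam * (D * F))‖ ≤ ‖Xi‖ * (l * (2 * ε * p)) :=
    opNorm_mul_le_of_le le_rfl (opNorm_mul_le_of_le hL (opNorm_mul_le_of_le hD hF))
  have h3 : ‖Xi‖ ≤ ‖annih lam * (D * F)‖ + ‖Xi * (Lam * (D * F))‖ := by
    conv_lhs => rw [h.slope]
    exact norm_sub_le _ _
  nlinarith [norm_nonneg Xi]

/-- The residual is a Lipschitz function of the perturbation: the equations that determine it
are a contraction in `Z` as long as the perturbation is small. -/
theorem IsResidual.norm_sub_le (h₁ : IsResidual lam f Lam F E₁ Z₁ D₁ Xi₁)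
    (h₂ : IsResidual lam f Lam F E₂ Z₂ D₂ Xi₂) (hL : ‖Lam‖ ≤ l)
    (hF : ‖F‖ ≤ p) (hE₁ : ‖E₁‖ ≤ ε) (hZ₁ : ‖Z₁‖ ≤ ε) (hE₂ : ‖E₂‖ ≤ ε) (hZ₂ : ‖Z₂‖ ≤ ε)
    (hs : 36 * (l * p * ε) ≤ 1) : ‖Z₁ - Z₂‖ ≤ 3 * ‖E₁ - E₂‖ := by
  have hl : 0 ≤ l := (norm_nonneg _).trans hL
  have hp : 0 ≤ p := (norm_nonneg _).trans hF
  have hε : 0 ≤ ε := (norm_nonneg _).trans hE₁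
  have hτ : 0 ≤ l * p * ε := by positivity
  have hD₁ := h₁.norm_diff_le hE₁ hZ₁
  have hD₂ := h₂.norm_diff_le hE₂ hZ₂
  have hX₂ := h₂.norm_slope_le hL hF hE₂ hZ₂ (by linarith)
  have hM := opNorm_annih_le lam
  have hMf := opNorm_annih_le f
  have hLt := opNorm_transpose_le hL
  have hFt := opNorm_transpose_le hF
  set z := ‖Z₁ - Z₂‖ with hz
  set x := ‖E₁ - E₂‖ with hx
  have hz0 : 0 ≤ z := norm_nonneg _
  have hx0 : 0 ≤ x := norm_nonneg _
  have hDD : ‖D₁ - D₂‖ ≤ x + z := by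
    rw [h₁.diff, h₂.diff, sub_sub_sub_comm]
    exact _root_.norm_sub_le _ _
  have hDDt : ‖D₁ᵀ - D₂ᵀ‖ ≤ x + z := by
    rw [← transpose_sub]; exact opNorm_transpose_le hDD
  -- the slopes
  have hXX : ‖Xi₁ - Xi₂‖ ≤ 4 * p * (x + z) := by
    have e : Xi₁ - Xi₂ = annih lam * ((D₁ - D₂) * F) - (Xi₁ - Xi₂) * (Lam * (D₁ * F))
        - Xi₂ * (Lam * ((D₁ - D₂) * F)) := by
      conv_lhs => rw [h₁.slope, h₂.slope]
      simp only [Matrix.mul_sub, Matrix.sub_mul]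
      abel
    have b1 : ‖annih lam * ((D₁ - D₂) * F)‖ ≤ 1 * ((x + z) * p) :=
      opNorm_mul_le_of_le hM (opNorm_mul_le_of_le hDD hF)
    have b2 : ‖(Xi₁ - Xi₂) * (Lam * (D₁ * F))‖ ≤ ‖Xi₁ - Xi₂‖ * (l * (2 * ε * p)) :=
      opNorm_mul_le_of_le le_rfl (opNorm_mul_le_of_le hL (opNorm_mul_le_of_le hD₁ hF))
    have b3 : ‖Xi₂ * (Lam * ((D₁ - D₂) * F))‖ ≤ 4 * (p * ε) * (l * ((x + z) * p)) :=
      opNorm_mul_le_of_le hX₂ (opNorm_mul_le_of_le hL (opNorm_mul_le_of_le hDD hF))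
    have b4 : ‖Xi₁ - Xi₂‖ ≤ 1 * ((x + z) * p) + ‖Xi₁ - Xi₂‖ * (l * (2 * ε * p))
        + 4 * (p * ε) * (l * ((x + z) * p)) := by
      conv_lhs => rw [e]
      refine (_root_.norm_sub_le _ _).trans (add_le_add ?_ b3)
      exact (_root_.norm_sub_le _ _).trans (add_le_add b1 b2)
    have hq : 0 ≤ p * (x + z) := by positivity
    nlinarith [norm_nonneg (Xi₁ - Xi₂)]
  have e : Z₁ - Z₂ = annih lam * ((E₁ - E₂) * annih f)
      - (Z₁ - Z₂) * (D₁ᵀ * (Lamᵀ * Fᵀ)) - Z₂ * ((D₁ᵀ - D₂ᵀ) * (Lamᵀ * Fᵀ))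
      - Lamᵀ * (Fᵀ * ((D₁ᵀ - D₂ᵀ) * (Z₁ * annih f)))
      - Lamᵀ * (Fᵀ * (D₂ᵀ * ((Z₁ - Z₂) * annih f)))
      - (Xi₁ - Xi₂) * (Lam * (D₁ * annih f)) - Xi₂ * (Lam * ((D₁ - D₂) * annih f)) := by
    conv_lhs => rw [h₁.main, h₂.main]
    simp only [Matrix.mul_sub, Matrix.sub_mul]
    abel
  have b0 : ‖annih lam * ((E₁ - E₂) * annih f)‖ ≤ 1 * (x * 1) :=
    opNorm_mul_le_of_le hM (opNorm_mul_le_of_le le_rfl hMf)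
  have b1 : ‖(Z₁ - Z₂) * (D₁ᵀ * (Lamᵀ * Fᵀ))‖ ≤ z * (2 * ε * (l * p)) :=
    opNorm_mul_le_of_le le_rfl
      (opNorm_mul_le_of_le (opNorm_transpose_le hD₁) (opNorm_mul_le_of_le hLt hFt))
  have b2 : ‖Z₂ * ((D₁ᵀ - D₂ᵀ) * (Lamᵀ * Fᵀ))‖ ≤ ε * ((x + z) * (l * p)) :=
    opNorm_mul_le_of_le hZ₂ (opNorm_mul_le_of_le hDDt (opNorm_mul_le_of_le hLt hFt))
  have b3 : ‖Lamᵀ * (Fᵀ * ((D₁ᵀ - D₂ᵀ) * (Z₁ * annih f)))‖ ≤ l * (p * ((x + z) * (ε * 1))) :=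
    opNorm_mul_le_of_le hLt
      (opNorm_mul_le_of_le hFt (opNorm_mul_le_of_le hDDt (opNorm_mul_le_of_le hZ₁ hMf)))
  have b4 : ‖Lamᵀ * (Fᵀ * (D₂ᵀ * ((Z₁ - Z₂) * annih f)))‖ ≤ l * (p * (2 * ε * (z * 1))) :=
    opNorm_mul_le_of_le hLt (opNorm_mul_le_of_le hFt
      (opNorm_mul_le_of_le (opNorm_transpose_le hD₂) (opNorm_mul_le_of_le le_rfl hMf)))
  have b5 : ‖(Xi₁ - Xi₂) * (Lam * (D₁ * annih f))‖ ≤ 4 * p * (x + z) * (l * (2 * ε * 1)) :=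
    opNorm_mul_le_of_le hXX (opNorm_mul_le_of_le hL (opNorm_mul_le_of_le hD₁ hMf))
  have b6 : ‖Xi₂ * (Lam * ((D₁ - D₂) * annih f))‖ ≤ 4 * (p * ε) * (l * ((x + z) * 1)) :=
    opNorm_mul_le_of_le hX₂ (opNorm_mul_le_of_le hL (opNorm_mul_le_of_le hDD hMf))
  have b : z ≤ 1 * (x * 1) + z * (2 * ε * (l * p)) + ε * ((x + z) * (l * p))
      + l * (p * ((x + z) * (ε * 1))) + l * (p * (2 * ε * (z * 1)))
      + 4 * p * (x + z) * (l * (2 * ε * 1)) + 4 * (p * ε) * (l * ((x + z) * 1)) := by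
    rw [hz]
    conv_lhs => rw [e]
    refine (_root_.norm_sub_le _ _).trans (add_le_add ?_ b6)
    refine (_root_.norm_sub_le _ _).trans (add_le_add ?_ b5)
    refine (_root_.norm_sub_le _ _).trans (add_le_add ?_ b4)
    refine (_root_.norm_sub_le _ _).trans (add_le_add ?_ b3)
    refine (_root_.norm_sub_le _ _).trans (add_le_add ?_ b2)
    exact (_root_.norm_sub_le _ _).trans (add_le_add b0 b1)
  -- the coefficient of `z` on the right is at most `1 / 2`
  have b' : z ≤ x + 18 * (l * p * ε) * z + 14 * (l * p * ε) * x := by linarith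
  have c1 : 36 * (l * p * ε) * z ≤ 1 * z := mul_le_mul_of_nonneg_right hs hz0
  have c2 : 36 * (l * p * ε) * x ≤ 1 * x := mul_le_mul_of_nonneg_right hs hx0
  linarith

/-- The second-order term of the residual `Z` in the perturbation, up to its sign, as a bilinear
map. -/
def quadTerm (lam : Matrix (Fin N) (Fin R) ℝ) (f : Matrix (Fin T) (Fin R) ℝ)
    (Lam : Matrix (Fin R) (Fin N) ℝ) (F : Matrix (Fin T) (Fin R) ℝ)
    (E₁ E₂ : Matrix (Fin N) (Fin T) ℝ) : Matrix (Fin N) (Fin T) ℝ :=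
  annih lam * (E₁ * (annih f * (E₂ᵀ * Lamᵀ))) * Fᵀ
    + Lamᵀ * (Fᵀ * (E₁ᵀ * (annih lam * (E₂ * annih f))))
    + annih lam * (E₁ * F) * (Lam * (E₂ * annih f))

theorem abs_trace_quadTerm_le (X : Matrix (Fin N) (Fin T) ℝ) (hL : ‖Lam‖ ≤ l) (hF : ‖F‖ ≤ p)
    {a b : ℝ} (h₁ : ‖E₁‖ ≤ a) (h₂ : ‖E₂‖ ≤ b) :
    |(Xᵀ * quadTerm lam f Lam F E₁ E₂).trace| ≤ √R * frob X * (3 * (l * p) * a * b) := by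
  have hM := opNorm_annih_le lam
  have hMf := opNorm_annih_le f
  have hLt := opNorm_transpose_le hL
  have hFt := opNorm_transpose_le hF
  have hc : 0 ≤ √R * frob X := mul_nonneg (Real.sqrt_nonneg _) (frob_nonneg _)
  have key : ∀ (U : Matrix (Fin N) (Fin R) ℝ) (V : Matrix (Fin R) (Fin T) ℝ) {u v : ℝ},
      ‖U‖ ≤ u → ‖V‖ ≤ v → |(Xᵀ * (U * V)).trace| ≤ √R * frob X * (u * v) := by
    intro U V u v hu hv
    exact (abs_trace_mul_mul_le X U V).trans (mul_le_mul_of_nonneg_left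
      (mul_le_mul hu hv (norm_nonneg _) ((norm_nonneg _).trans hu)) hc)
  have b1 := key _ _ (opNorm_mul_le_of_le hM (opNorm_mul_le_of_le h₁ (opNorm_mul_le_of_le hMf
    (opNorm_mul_le_of_le (opNorm_transpose_le h₂) hLt)))) hFt
  have b2 := key _ _ hLt (opNorm_mul_le_of_le hFt (opNorm_mul_le_of_le (opNorm_transpose_le h₁)
    (opNorm_mul_le_of_le hM (opNorm_mul_le_of_le h₂ hMf))))
  have b3 := key _ _ (opNorm_mul_le_of_le hM (opNorm_mul_le_of_le h₁ hF))
    (opNorm_mul_le_of_le hL (opNorm_mul_le_of_le h₂ hMf))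
  rw [quadTerm, Matrix.mul_add, Matrix.mul_add, trace_add, trace_add]
  refine (abs_add_three _ _ _).trans ((add_le_add (add_le_add b1 b2) b3).trans (le_of_eq ?_))
  ring

/-- The residual agrees with `M_λ E M_f` minus the quadratic term up to third order. Every error
term factors through dimension `R`, so that a trace pairing costs only `√R`. -/
theorem IsResidual.abs_trace_sub_le (h : IsResidual lam f Lam F E Z D Xi)
    (X : Matrix (Fin N) (Fin T) ℝ) (hL : ‖Lam‖ ≤ l)
    (hF : ‖F‖ ≤ p) (hE : ‖E‖ ≤ ε) (hZ : ‖Z‖ ≤ ε) (hs : 4 * (l * p * ε) ≤ 1) :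
    |(Xᵀ * (Z - (annih lam * (E * annih f) - quadTerm lam f Lam F E E))).trace| ≤
      √R * frob X * (50 * (l * p) ^ 2 * ε ^ 3) := by
  have hl : 0 ≤ l := (norm_nonneg _).trans hL
  have hp : 0 ≤ p := (norm_nonneg _).trans hF
  have hε : 0 ≤ ε := (norm_nonneg _).trans hE
  have hD := h.norm_diff_le hE hZ
  have hXi := h.norm_slope_le hL hF hE hZ hs
  have hM := opNorm_annih_le lam
  have hMf := opNorm_annih_le f
  have hLt := opNorm_transpose_le hL
  have hFt := opNorm_transpose_le hF
  have hEt := opNorm_transpose_le hE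
  have hDt := opNorm_transpose_le hD
  have hc : 0 ≤ √R * frob X := mul_nonneg (Real.sqrt_nonneg _) (frob_nonneg _)
  have key : ∀ (U : Matrix (Fin N) (Fin R) ℝ) (V : Matrix (Fin R) (Fin T) ℝ) {u v : ℝ},
      ‖U‖ ≤ u → ‖V‖ ≤ v → |(Xᵀ * (U * V)).trace| ≤ √R * frob X * (u * v) := by
    intro U V u v hu hv
    exact (abs_trace_mul_mul_le X U V).trans (mul_le_mul_of_nonneg_left
      (mul_le_mul hu hv (norm_nonneg _) ((norm_nonneg _).trans hu)) hc)
  -- the components of the residual along the ranges of `lam` and `f` are of second order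
  have hLZ : ‖Lam * Z‖ ≤ l * (l * (p * (2 * ε * ε))) := by
    rw [h.lam_mul, norm_neg]
    exact opNorm_mul_le_of_le hL (opNorm_mul_le_of_le hLt (opNorm_mul_le_of_le hFt
      (opNorm_mul_le_of_le hDt hZ)))
  have hZF : ‖Z * F‖ ≤ ε * (2 * ε * (l * (p * p))) := by
    rw [h.mul_f, norm_neg]
    exact opNorm_mul_le_of_le hZ (opNorm_mul_le_of_le hDt (opNorm_mul_le_of_le hLt
      (opNorm_mul_le_of_le hFt hF)))
  obtain ⟨G, hG⟩ : ∃ G, G = annih lam * (E * annih f) := ⟨_, rfl⟩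
  have hw : ‖Z - G‖ ≤ 12 * (l * p) * ε ^ 2 := by
    have e : Z - G = -(Z * (Dᵀ * (Lamᵀ * Fᵀ)))
      - Lamᵀ * (Fᵀ * (Dᵀ * (Z * annih f))) - Xi * (Lam * (D * annih f)) := by
      conv_lhs => rw [h.main, hG]
      abel
    have b1 : ‖-(Z * (Dᵀ * (Lamᵀ * Fᵀ)))‖ ≤ ε * (2 * ε * (l * p)) := by
      rw [norm_neg]
      exact opNorm_mul_le_of_le hZ (opNorm_mul_le_of_le hDt (opNorm_mul_le_of_le hLt hFt))
    have b2 : ‖Lamᵀ * (Fᵀ * (Dᵀ * (Z * annih f)))‖ ≤ l * (p * (2 * ε * (ε * 1))) :=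
      opNorm_mul_le_of_le hLt (opNorm_mul_le_of_le hFt (opNorm_mul_le_of_le hDt
        (opNorm_mul_le_of_le hZ hMf)))
    have b3 : ‖Xi * (Lam * (D * annih f))‖ ≤ 4 * (p * ε) * (l * (2 * ε * 1)) :=
      opNorm_mul_le_of_le hXi (opNorm_mul_le_of_le hL (opNorm_mul_le_of_le hD hMf))
    rw [e]
    refine (_root_.norm_sub_le _ _).trans ((add_le_add ((_root_.norm_sub_le _ _).trans
      (add_le_add b1 b2)) b3).trans (le_of_eq ?_))
    ring
  have t1 : ‖(Z - G) * (Eᵀ * Lamᵀ) - Z * (Lam * Z)ᵀ‖ ≤ 14 * (l * p) * l * ε ^ 3 := by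
    have b1 := opNorm_mul_le_of_le hw (opNorm_mul_le_of_le hEt hLt)
    have b2 := opNorm_mul_le_of_le hZ (opNorm_transpose_le hLZ)
    refine (_root_.norm_sub_le _ _).trans ((add_le_add b1 b2).trans (le_of_eq ?_))
    ring
  have t2 : ‖(Fᵀ * (Eᵀ * (Z - G)) - (Z * F)ᵀ * Z) * annih f‖ ≤ 14 * (l * p) * p * ε ^ 3 := by
    have b1 := opNorm_mul_le_of_le hFt (opNorm_mul_le_of_le hEt hw)
    have b2 := opNorm_mul_le_of_le (opNorm_transpose_le hZF) hZ
    refine (opNorm_mul_le_of_le ((_root_.norm_sub_le _ _).trans (add_le_add b1 b2)) hMf).trans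
      (le_of_eq ?_)
    ring
  have t3 : ‖annih lam * (Z * F) + Xi * (Lam * (D * F))‖ ≤ 10 * (l * p) * p * ε ^ 2 := by
    have b1 := opNorm_mul_le_of_le hM hZF
    have b2 := opNorm_mul_le_of_le hXi (opNorm_mul_le_of_le hL (opNorm_mul_le_of_le hD hF))
    refine (norm_add_le _ _).trans ((add_le_add b1 b2).trans (le_of_eq ?_))
    ring
  have t3' : ‖Lam * (D * annih f)‖ ≤ l * (2 * ε * 1) :=
    opNorm_mul_le_of_le hL (opNorm_mul_le_of_le hD hMf)
  have t4 : ‖annih lam * (E * F)‖ ≤ 1 * (ε * p) :=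
    opNorm_mul_le_of_le hM (opNorm_mul_le_of_le hE hF)
  have t4' : ‖Lam * Z * annih f‖ ≤ l * (l * (p * (2 * ε * ε))) * 1 :=
    opNorm_mul_le_of_le hLZ hMf
  have k1 := key _ _ t1 hFt
  have k2 := key _ _ hLt t2
  have k3 := key _ _ t3 t3'
  have k4 := key _ _ t4 t4'
  have e : Z - (annih lam * (E * annih f) - quadTerm lam f Lam F E E) =
      (annih lam * (Z * F) + Xi * (Lam * (D * F))) * (Lam * (D * annih f))
      + annih lam * (E * F) * (Lam * Z * annih f)
      - ((Z - G) * (Eᵀ * Lamᵀ) - Z * (Lam * Z)ᵀ) * Fᵀ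
      - Lamᵀ * ((Fᵀ * (Eᵀ * (Z - G)) - (Z * F)ᵀ * Z) * annih f) := by
    have hX : annih lam * (Z * F) + Xi * (Lam * (D * F)) = annih lam * (E * F) - Xi := by
      conv_rhs => rw [h.slope, h.diff]
      rw [h.diff]
      simp only [Matrix.mul_sub, Matrix.sub_mul]
      abel
    have e0 : Z - (annih lam * (E * annih f) - quadTerm lam f Lam F E E) =
        quadTerm lam f Lam F E E - Z * (Dᵀ * (Lamᵀ * Fᵀ))
          - Lamᵀ * (Fᵀ * (Dᵀ * (Z * annih f))) - Xi * (Lam * (D * annih f)) := by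
      conv_lhs => rw [h.main]
      abel
    rw [e0, hX, quadTerm, hG, h.diff]
    simp only [transpose_sub, transpose_mul, Matrix.mul_sub, Matrix.sub_mul, Matrix.mul_assoc,
      annih_idem]
    abel
  rw [e, Matrix.mul_sub, Matrix.mul_sub, Matrix.mul_add, trace_sub, trace_sub, trace_add]
  refine (abs_sub _ _).trans ((add_le_add ((abs_sub _ _).trans (add_le_add
    ((abs_add_le _ _).trans (add_le_add k3 k4)) k1)) k2).trans (le_of_eq ?_))
  ring

end Perturbation

/-! ### Gradients of the profile objective and of the remainder -/

section Gradients

open scoped Matrix.Norms.L2Operator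

variable {N T K R : ℕ}

theorem hasGradientAt_of_abs_sub_le {g : EuclideanSpace ℝ (Fin K) → ℝ}
    {v x : EuclideanSpace ℝ (Fin K)} {C : ℝ}
    (h : ∀ᶠ y in 𝓝 x, |g y - g x - inner ℝ v (y - x)| ≤ C * ‖y - x‖ ^ 2) :
    HasGradientAt g v x := by
  rw [hasGradientAt_iff_isLittleO]
  have h1 : (fun y => g y - g x - inner ℝ v (y - x)) =O[𝓝 x] fun y => ‖y - x‖ ^ 2 := by
    refine Asymptotics.IsBigO.of_bound C ?_
    filter_upwards [h] with y hy
    simpa using hy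
  refine h1.trans_isLittleO ?_
  have h2 := Asymptotics.isLittleO_norm_pow_id (E' := EuclideanSpace ℝ (Fin K)) one_lt_two
  refine h2.comp_tendsto (k := fun y => y - x) ?_
  exact tendsto_sub_nhds_zero_iff.2 tendsto_id

theorem abs_apply_le_norm (h : EuclideanSpace ℝ (Fin K)) (k : Fin K) : |h k| ≤ ‖h‖ :=
  PiLp.norm_apply_le h k

theorem norm_le_sum_abs (h : EuclideanSpace ℝ (Fin K)) : ‖h‖ ≤ ∑ k, |h k| := by
  rw [EuclideanSpace.norm_eq]
  refine Real.sqrt_le_iff.2 ⟨Finset.sum_nonneg fun _ _ => abs_nonneg _, ?_⟩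
  exact Finset.sum_sq_le_sq_sum_of_nonneg fun _ _ => abs_nonneg _

theorem lincomb_sub (b c : EuclideanSpace ℝ (Fin K)) (X : Fin K → Matrix (Fin N) (Fin T) ℝ) :
    lincomb (b - c) X = lincomb b X - lincomb c X := by
  simp [lincomb, sub_smul, Finset.sum_sub_distrib]

theorem opNorm_lincomb_le (b : EuclideanSpace ℝ (Fin K)) (X : Fin K → Matrix (Fin N) (Fin T) ℝ) :
    ‖lincomb b X‖ ≤ ‖b‖ * ∑ k, ‖X k‖ := by
  rw [lincomb, Finset.mul_sum]
  refine norm_sum_le_of_le _ fun k _ => ?_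
  rw [norm_smul]
  exact mul_le_mul_of_nonneg_right (abs_apply_le_norm b k) (norm_nonneg _)

theorem hessW_transpose (lam : Matrix (Fin N) (Fin R) ℝ) (f : Matrix (Fin T) (Fin R) ℝ)
    (X : Fin K → Matrix (Fin N) (Fin T) ℝ) : (hessW lam f X)ᵀ = hessW lam f X := by
  ext k j
  simp only [hessW, transpose_apply, of_apply]
  congr 1
  rw [← trace_transpose]
  simp only [transpose_mul, transpose_transpose, annih_transpose]
  rw [← Matrix.mul_assoc, ← Matrix.mul_assoc, trace_mul_comm, ← Matrix.mul_assoc,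
    ← Matrix.mul_assoc]

theorem hasGradientAt_quadObjective (Y : Matrix (Fin N) (Fin T) ℝ)
    (X : Fin K → Matrix (Fin N) (Fin T) ℝ) (lam : Matrix (Fin N) (Fin R) ℝ)
    (f : Matrix (Fin T) (Fin R) ℝ) (e : Matrix (Fin N) (Fin T) ℝ)
    (b₀ b : EuclideanSpace ℝ (Fin K)) :
    HasGradientAt (quadObjective Y X lam f e b₀)
      ((2 : ℝ) • WithLp.toLp 2 (hessW lam f X *ᵥ (b - b₀).ofLp)
        - (2 / √((N : ℝ) * T)) • scoreC lam f X e) b := by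
  refine hasGradientAt_of_abs_sub_le (C := ‖hessW lam f X‖) (Eventually.of_forall fun y => ?_)
  have hW := hessW_transpose lam f X
  set W := hessW lam f X
  have hin : ∀ u v : EuclideanSpace ℝ (Fin K), inner ℝ u v = v.ofLp ⬝ᵥ u.ofLp := fun u v => by
    simp [EuclideanSpace.inner_eq_star_dotProduct]
  have hy : y - b₀ = (y - b) + (b - b₀) := by abel
  have e1 : quadObjective Y X lam f e b₀ y - quadObjective Y X lam f e b₀ b
      - inner ℝ ((2 : ℝ) • WithLp.toLp 2 (W *ᵥ (b - b₀).ofLp)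
        - (2 / √((N : ℝ) * T)) • scoreC lam f X e) (y - b) =
      (y - b).ofLp ⬝ᵥ (W *ᵥ (y - b).ofLp) := by
    have hsym : (b - b₀).ofLp ⬝ᵥ (W *ᵥ (y - b).ofLp) = (y - b).ofLp ⬝ᵥ (W *ᵥ (b - b₀).ofLp) := by
      rw [dotProduct_mulVec, ← mulVec_transpose, hW, dotProduct_comm]
    rw [hin, quadObjective, quadObjective, hy]
    generalize y - b = h at *
    simp only [WithLp.ofLp_add, WithLp.ofLp_sub, WithLp.ofLp_smul, mulVec_add, add_dotProduct,
      dotProduct_add, dotProduct_sub, dotProduct_smul, smul_eq_mul] at hsym ⊢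
    simp only [mulVec_sub, sub_dotProduct, dotProduct_sub] at hsym ⊢
    linear_combination hsym
  rw [e1, ← hin]
  refine (abs_real_inner_le_norm (WithLp.toLp 2 (W *ᵥ (y - b).ofLp)) (y - b)).trans ?_
  have := l2_opNorm_mulVec W (y - b)
  calc _ ≤ ‖W‖ * ‖y - b‖ * ‖y - b‖ := mul_le_mul_of_nonneg_right this (norm_nonneg _)
    _ = _ := by ring

theorem hasGradientAt_remainder {Y : Matrix (Fin N) (Fin T) ℝ}
    {X : Fin K → Matrix (Fin N) (Fin T) ℝ} {b g : EuclideanSpace ℝ (Fin K)}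
    (hg : HasGradientAt (profileObjective R Y X) g b) (lam : Matrix (Fin N) (Fin R) ℝ)
    (f : Matrix (Fin T) (Fin R) ℝ) (e : Matrix (Fin N) (Fin T) ℝ)
    (b₀ : EuclideanSpace ℝ (Fin K)) :
    HasGradientAt (remainder Y X lam f e b₀) (((N : ℝ) * T) •
      (g - ((2 : ℝ) • WithLp.toLp 2 (hessW lam f X *ᵥ (b - b₀).ofLp)
        - (2 / √((N : ℝ) * T)) • scoreC lam f X e))) b := by
  have h := (hg.hasFDerivAt.sub
    (hasGradientAt_quadObjective Y X lam f e b₀ b).hasFDerivAt).const_mul ((N : ℝ) * T)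
  rw [hasGradientAt_iff_hasFDerivAt, map_smul, map_sub]
  exact h

/-- The score formula holds wherever the profile objective is differentiable. -/
theorem differentiableAt_remainder_and_gradient {Y : Matrix (Fin N) (Fin T) ℝ}
    {X : Fin K → Matrix (Fin N) (Fin T) ℝ} {b : EuclideanSpace ℝ (Fin K)}
    (h : DifferentiableAt ℝ (profileObjective R Y X) b) (lam : Matrix (Fin N) (Fin R) ℝ)
    (f : Matrix (Fin T) (Fin R) ℝ) (e : Matrix (Fin N) (Fin T) ℝ)
    (b₀ : EuclideanSpace ℝ (Fin K)) :
    DifferentiableAt ℝ (remainder Y X lam f e b₀) b ∧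
      ∇ (profileObjective R Y X) b =
        (2 : ℝ) • WithLp.toLp 2 (hessW lam f X *ᵥ (b - b₀).ofLp)
          - (2 / √((N : ℝ) * T)) • scoreC lam f X e
          + ((N : ℝ) * T)⁻¹ • ∇ (remainder Y X lam f e b₀) b := by
  have hr := hasGradientAt_remainder h.hasGradientAt lam f e b₀
  refine ⟨hr.differentiableAt, ?_⟩
  rw [hr.gradient]
  by_cases hNT : (N : ℝ) * T = 0
  · -- an empty panel: every term vanishes, since `0⁻¹ = 0`
    have h0 : profileObjective R Y X = fun _ => 0 := by
      funext b
      simp [profileObjective, lsObjective, hNT]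
    have hW : hessW lam f X = 0 := by
      ext k j
      simp [hessW, hNT]
    rw [h0, hW, hNT]
    simp
  · rw [inv_smul_smul₀ hNT]
    abel

/-- The minimum that defines the profile objective is attained; the minimizer is as in
`exists_best_approx`, and gives an upper bound for the objective at all parameter values. -/
theorem exists_profile_residual (R : ℕ) (Y : Matrix (Fin N) (Fin T) ℝ)
    (X : Fin K → Matrix (Fin N) (Fin T) ℝ) (b : EuclideanSpace ℝ (Fin K)) :
    ∃ (U : Matrix (Fin N) (Fin R) ℝ) (V : Matrix (Fin T) (Fin R) ℝ)
      (Z : Matrix (Fin N) (Fin T) ℝ),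
      Z = Y - lincomb b X - U * Vᵀ ∧ Uᵀ * Z = 0 ∧ Z * V = 0 ∧
      (∀ (B : Matrix (Fin N) (Fin R) ℝ) (C : Matrix (Fin T) (Fin R) ℝ),
        ‖Z‖ ≤ ‖Y - lincomb b X - B * Cᵀ‖) ∧
      profileObjective R Y X b = ((N : ℝ) * T)⁻¹ * frob Z ^ 2 ∧
      ∀ c, profileObjective R Y X c ≤ ((N : ℝ) * T)⁻¹ * frob (Z - lincomb (c - b) X) ^ 2 := by
  obtain ⟨U, V, hU, hV, hbest⟩ := exists_best_approx R (Y - lincomb b X)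
  have hbdd : ∀ c, BddBelow (Set.range fun p : Matrix (Fin N) (Fin R) ℝ ×
      Matrix (Fin T) (Fin R) ℝ => lsObjective Y X c p.1 p.2) := fun c => by
    refine ⟨0, ?_⟩
    rintro _ ⟨p, rfl⟩
    simp only [lsObjective, trace_self_eq_frob_sq]
    positivity
  refine ⟨U, V, _, rfl, hU, hV, fun B C => (hbest B C).2, ?_, fun c => ?_⟩
  · refine le_antisymm ((ciInf_le (hbdd b) (U, V)).trans (le_of_eq ?_)) (le_ciInf fun p => ?_)
    · simp only [lsObjective, trace_self_eq_frob_sq]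
    · simp only [lsObjective, trace_self_eq_frob_sq]
      exact mul_le_mul_of_nonneg_left (hbest p.1 p.2).1 (by positivity)
  · refine (ciInf_le (hbdd c) (U, V)).trans (le_of_eq ?_)
    simp only [lsObjective, trace_self_eq_frob_sq]
    congr 3
    rw [lincomb_sub]
    abel

theorem frob_sub_sq {m n : ℕ} (A B : Matrix (Fin m) (Fin n) ℝ) :
    frob (A - B) ^ 2 = frob A ^ 2 - 2 * (Aᵀ * B).trace + frob B ^ 2 := by
  have h : (Bᵀ * A).trace = (Aᵀ * B).trace := by
    rw [← trace_transpose, transpose_mul, transpose_transpose]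
  simp only [← trace_self_eq_frob_sq, transpose_sub, Matrix.sub_mul, Matrix.mul_sub, trace_sub, h]
  ring

theorem trace_mul_lincomb (Z : Matrix (Fin N) (Fin T) ℝ) (b : EuclideanSpace ℝ (Fin K))
    (X : Fin K → Matrix (Fin N) (Fin T) ℝ) :
    (Zᵀ * lincomb b X).trace = ∑ k, b k * ((X k)ᵀ * Z).trace := by
  rw [lincomb, Matrix.mul_sum, trace_sum]
  refine Finset.sum_congr rfl fun k _ => ?_
  rw [Matrix.mul_smul, trace_smul, smul_eq_mul, ← trace_transpose, transpose_mul,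
    transpose_transpose]

variable {lam : Matrix (Fin N) (Fin R) ℝ} {f : Matrix (Fin T) (Fin R) ℝ}
  {Lam : Matrix (Fin R) (Fin N) ℝ} {F : Matrix (Fin T) (Fin R) ℝ}

/-- The residual at the minimizer satisfies the residual equations. It is no larger in operator norm
than the perturbation, because `λf'` is a competitor of the minimizer. -/
theorem FactorInverse.exists_profile_isResidual (hfac : FactorInverse lam f Lam F)
    {Y e : Matrix (Fin N) (Fin T) ℝ} {X : Fin K → Matrix (Fin N) (Fin T) ℝ}
    {b₀ : EuclideanSpace ℝ (Fin K)} (hY : Y = lincomb b₀ X + lam * fᵀ + e)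
    {l p : ℝ} (hL : ‖Lam‖ ≤ l) (hF : ‖F‖ ≤ p) {b : EuclideanSpace ℝ (Fin K)}
    (hs : 36 * (l * p * ‖e - lincomb (b - b₀) X‖) ≤ 1) :
    ∃ Z D Xi, IsResidual lam f Lam F (e - lincomb (b - b₀) X) Z D Xi ∧
      ‖Z‖ ≤ ‖e - lincomb (b - b₀) X‖ ∧
      profileObjective R Y X b = ((N : ℝ) * T)⁻¹ * frob Z ^ 2 ∧
      ∀ c, profileObjective R Y X c ≤ ((N : ℝ) * T)⁻¹ * frob (Z - lincomb (c - b) X) ^ 2 := by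
  obtain ⟨U, V, Z, hZ, hU, hV, hnorm, h1, h2⟩ := exists_profile_residual R Y X b
  set E := e - lincomb (b - b₀) X with hE
  have hA : Y - lincomb b X = lam * fᵀ + E := by rw [hE, hY, lincomb_sub]; abel
  rw [hA] at hZ
  have hZE : ‖Z‖ ≤ ‖E‖ := by
    have := hnorm lam f
    rwa [hA, add_sub_cancel_left] at this
  have hsmall : ‖Lam * ((E - Z) * F)‖ < 1 := by
    have hD : ‖E - Z‖ ≤ 2 * ‖E‖ := by linarith [norm_sub_le E Z]
    have := opNorm_mul_le_of_le hL (opNorm_mul_le_of_le hD hF)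
    linarith
  obtain ⟨Xi, hXi⟩ := hfac.exists_isResidual hZ hU hV hsmall
  exact ⟨Z, _, Xi, hXi, hZE, h1, h2⟩

/-- Envelope theorem: close to the true model, the gradient of the profile objective is the
partial gradient of the least squares objective at its minimizer. The residual at either of two
parameter values bounds the increment of the objective from one side, and the two bounds agree to
first order because the residual is Lipschitz. -/
theorem FactorInverse.exists_hasGradientAt_profile (hfac : FactorInverse lam f Lam F)
    {Y e : Matrix (Fin N) (Fin T) ℝ} {X : Fin K → Matrix (Fin N) (Fin T) ℝ}
    {b₀ : EuclideanSpace ℝ (Fin K)} (hY : Y = lincomb b₀ X + lam * fᵀ + e)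
    {l p : ℝ} (hL : ‖Lam‖ ≤ l) (hF : ‖F‖ ≤ p) {b : EuclideanSpace ℝ (Fin K)}
    (hs : 36 * (l * p * ‖e - lincomb (b - b₀) X‖) < 1) :
    ∃ Z D Xi, IsResidual lam f Lam F (e - lincomb (b - b₀) X) Z D Xi ∧
      ‖Z‖ ≤ ‖e - lincomb (b - b₀) X‖ ∧
      HasGradientAt (profileObjective R Y X)
        (WithLp.toLp 2 fun k => -(2 * ((N : ℝ) * T)⁻¹ * ((X k)ᵀ * Z).trace)) b := by
  obtain ⟨Z, D, Xi, hres, hZ, hval, hub⟩ := hfac.exists_profile_isResidual hY hL hF hs.le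
  refine ⟨Z, D, Xi, hres, hZ, ?_⟩
  set q := ((N : ℝ) * T)⁻¹ with hq
  have hq0 : 0 ≤ q := by positivity
  set S := ∑ k, ‖X k‖
  have hS : 0 ≤ S := Finset.sum_nonneg fun _ _ => norm_nonneg _
  refine hasGradientAt_of_abs_sub_le (C := 7 * q * (T * S ^ 2)) ?_
  have hcont : Continuous fun c => 36 * (l * p * ‖e - lincomb (c - b₀) X‖) := by
    unfold lincomb
    fun_prop
  filter_upwards [(hcont.tendsto b).eventually_lt_const hs] with c hc
  obtain ⟨Z', D', Xi', hres', hZ', hval', hub'⟩ := hfac.exists_profile_isResidual hY hL hF hc.le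
  set H := lincomb (c - b) X with hH
  have hl : 0 ≤ l := (norm_nonneg _).trans hL
  have hp : 0 ≤ p := (norm_nonneg _).trans hF
  have hHneg : lincomb (b - c) X = -H := by rw [hH, lincomb_sub, lincomb_sub]; abel
  have hlip : ‖Z' - Z‖ ≤ 3 * ‖H‖ := by
    have := hres'.norm_sub_le hres hL hF (le_max_left _ _) (hZ'.trans (le_max_left _ _))
      (le_max_right _ _) (hZ.trans (le_max_right _ _)) (by
        rcases max_choice ‖e - lincomb (c - b₀) X‖ ‖e - lincomb (b - b₀) X‖ with h | h <;> rw [h]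
        exacts [hc.le, hs.le])
    have e1 : e - lincomb (c - b₀) X - (e - lincomb (b - b₀) X) = -H := by
      rw [hH, lincomb_sub, lincomb_sub, lincomb_sub]; abel
    rwa [e1, norm_neg] at this
  have hHn : ‖H‖ ≤ ‖c - b‖ * S := opNorm_lincomb_le _ _
  have hHF : frob H ≤ √T * (‖c - b‖ * S) :=
    (frob_le_sqrt_card_mul H).trans (mul_le_mul_of_nonneg_left hHn (Real.sqrt_nonneg _))
  have hZF : frob (Z' - Z) ≤ √T * (3 * (‖c - b‖ * S)) :=
    (frob_le_sqrt_card_mul _).trans (mul_le_mul_of_nonneg_left (by linarith) (Real.sqrt_nonneg _))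
  have hT : √T * √T = (T : ℝ) := Real.mul_self_sqrt (Nat.cast_nonneg _)
  have hHF2 : frob H ^ 2 ≤ T * (‖c - b‖ * S) ^ 2 := by
    have := pow_le_pow_left₀ (frob_nonneg _) hHF 2
    rwa [mul_pow, sq √_, hT] at this
  have hcross : |((Z' - Z)ᵀ * H).trace| ≤ 3 * (T * (‖c - b‖ * S) ^ 2) := by
    refine (abs_trace_le _ _).trans ((mul_le_mul hZF hHF (frob_nonneg _)
      ((frob_nonneg _).trans hZF)).trans (le_of_eq ?_))
    linear_combination 3 * (‖c - b‖ * S) ^ 2 * hT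
  have hin : inner ℝ (WithLp.toLp 2 fun k => -(2 * q * ((X k)ᵀ * Z).trace)) (c - b) =
      -(2 * q * (Zᵀ * H).trace) := by
    rw [hH, trace_mul_lincomb, EuclideanSpace.inner_eq_star_dotProduct, dotProduct,
      Finset.mul_sum, ← Finset.sum_neg_distrib]
    refine Finset.sum_congr rfl fun k _ => ?_
    simp
    ring
  have hup := hub c
  have hlo := hub' b
  rw [hHneg, sub_neg_eq_add] at hlo
  have e2 : frob (Z' + H) ^ 2 = frob Z' ^ 2 + 2 * (Z'ᵀ * H).trace + frob H ^ 2 := by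
    have h1 := frob_sub_sq Z' (-H)
    have h2 := frob_sub_sq 0 H
    have h3 : frob (0 : Matrix (Fin N) (Fin T) ℝ) = 0 := by simp [frob]
    rw [zero_sub, h3, transpose_zero, Matrix.zero_mul, trace_zero] at h2
    rw [sub_neg_eq_add, Matrix.mul_neg, trace_neg, h2] at h1
    linarith
  rw [frob_sub_sq, mul_add, mul_sub, ← hval, ← hH] at hup
  rw [e2, mul_add, mul_add, ← hval', ← hq] at hlo
  rw [transpose_sub, Matrix.sub_mul, trace_sub] at hcross
  have hc2 := abs_le.1 hcross
  have m1 := mul_le_mul_of_nonneg_left hHF2 hq0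
  have m2 := mul_le_mul_of_nonneg_left hc2.2 hq0
  have m3 : 0 ≤ q * (T * (‖c - b‖ * S) ^ 2) :=
    mul_nonneg hq0 (mul_nonneg (Nat.cast_nonneg _) (sq_nonneg _))
  rw [hin, abs_le]
  rw [mul_pow] at m1 m2 m3
  generalize (Zᵀ * H).trace = u at *
  generalize (Z'ᵀ * H).trace = u' at *
  generalize profileObjective R Y X c = Lc at *
  generalize profileObjective R Y X b = Lb at *
  clear_value q S
  constructor <;> linarith

end Gradients

/-! ### The remainder bound for given data -/

section Deterministic

open scoped Matrix.Norms.L2Operator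

variable {N T K R : ℕ}

/-- If the Gram matrix is at least `s > 0`, it is invertible, the pseudoinverse in the annihilator
is its inverse, and the left inverse of the matrix has norm at most `1/√s`. -/
theorem annih_eq_and_norm_le_of_gram_ge {m n : ℕ} {A : Matrix (Fin m) (Fin n) ℝ} {s : ℝ}
    (hs : 0 < s) (h : ∀ x, s * (x ⬝ᵥ x) ≤ x ⬝ᵥ ((Aᵀ * A) *ᵥ x)) :
    (Aᵀ * A)⁻¹ * (Aᵀ * A) = 1 ∧ annih A = 1 - A * ((Aᵀ * A)⁻¹ * Aᵀ) ∧
      ‖A * (Aᵀ * A)⁻¹‖ ≤ (√s)⁻¹ := by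
  have hinj : IsUnit (Aᵀ * A).det := by
    rw [isUnit_iff_ne_zero, ne_eq, ← exists_mulVec_eq_zero_iff, not_exists]
    rintro x ⟨hx0, hx⟩
    have h1 := h x
    rw [hx, dotProduct_zero] at h1
    have h0 : 0 ≤ x ⬝ᵥ x := dotProduct_self_nonneg_real x
    have h2 : x ⬝ᵥ x = 0 := by nlinarith
    exact hx0 (dotProduct_self_eq_zero.1 h2)
  have hl : (Aᵀ * A)⁻¹ * (Aᵀ * A) = 1 := nonsing_inv_mul _ hinj
  have hr : (Aᵀ * A) * (Aᵀ * A)⁻¹ = 1 := mul_nonsing_inv _ hinj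
  refine ⟨hl, ?_, ?_⟩
  · obtain ⟨h1, -⟩ := symmPinv_penrose (gram_isHermitian A)
    have h2 : symmPinv (gram_isHermitian A) = (Aᵀ * A)⁻¹ := by
      generalize symmPinv (gram_isHermitian A) = H at h1
      generalize Aᵀ * A = G at *
      have : H = G⁻¹ * (G * H * G) * G⁻¹ := by
        rw [Matrix.mul_assoc G H, ← Matrix.mul_assoc G⁻¹, hl, Matrix.one_mul, Matrix.mul_assoc H,
          hr, Matrix.mul_one]
      rw [this, h1, hl, Matrix.one_mul]
    rw [annih, h2, Matrix.mul_assoc]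
  · refine opNorm_le_of_mulVec (by positivity) fun x => ?_
    rw [inv_pow, Real.sq_sqrt hs.le, ← mulVec_mulVec]
    obtain ⟨y, hy⟩ : ∃ y, y = (Aᵀ * A)⁻¹ *ᵥ x := ⟨_, rfl⟩
    rw [← hy]
    have e1 : (A *ᵥ y) ⬝ᵥ (A *ᵥ y) = y ⬝ᵥ x := by
      rw [mulVec_dotProduct_mulVec, hy, mulVec_mulVec _ (Aᵀ * A), hr, one_mulVec]
    have e2 : s * (y ⬝ᵥ y) ≤ y ⬝ᵥ x := by
      rw [← e1, mulVec_dotProduct_mulVec]; exact h y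
    have e3 : (y ⬝ᵥ x) ^ 2 ≤ (y ⬝ᵥ y) * (x ⬝ᵥ x) := by
      have := Finset.sum_mul_sq_le_sq_mul_sq Finset.univ y x
      simpa [dotProduct, sq] using this
    have e4 : 0 ≤ y ⬝ᵥ x := by
      rw [← e1]
      exact dotProduct_self_nonneg_real _
    have e5 : 0 ≤ x ⬝ᵥ x := dotProduct_self_nonneg_real x
    rw [e1, inv_mul_eq_div, le_div_iff₀ hs]
    rcases e4.eq_or_lt with h0 | h0
    · rw [← h0]; simpa using e5
    · nlinarith

theorem exists_factorInverse {lam : Matrix (Fin N) (Fin R) ℝ} {f : Matrix (Fin T) (Fin R) ℝ}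
    {s t : ℝ} (hs : 0 < s) (ht : 0 < t)
    (hlam : ∀ x, s * (x ⬝ᵥ x) ≤ x ⬝ᵥ ((lamᵀ * lam) *ᵥ x))
    (hf : ∀ x, t * (x ⬝ᵥ x) ≤ x ⬝ᵥ ((fᵀ * f) *ᵥ x)) :
    FactorInverse lam f ((lamᵀ * lam)⁻¹ * lamᵀ) (f * (fᵀ * f)⁻¹) ∧
      ‖(lamᵀ * lam)⁻¹ * lamᵀ‖ ≤ (√s)⁻¹ ∧ ‖f * (fᵀ * f)⁻¹‖ ≤ (√t)⁻¹ := by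
  have htr : ∀ {m n : ℕ} (A : Matrix (Fin m) (Fin n) ℝ),
      (A * (Aᵀ * A)⁻¹)ᵀ = (Aᵀ * A)⁻¹ * Aᵀ := fun A => by
    rw [transpose_mul, transpose_nonsing_inv, transpose_mul, transpose_transpose]
  obtain ⟨h1, h2, h3⟩ := annih_eq_and_norm_le_of_gram_ge hs hlam
  obtain ⟨h4, h5, h6⟩ := annih_eq_and_norm_le_of_gram_ge ht hf
  refine ⟨⟨?_, ?_, h2, ?_⟩, ?_, h6⟩
  · rw [Matrix.mul_assoc, h1]
  · rw [htr, Matrix.mul_assoc, h4]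
  · rw [htr, h5]
  · rw [← htr, opNorm_transpose]; exact h3

variable {lam : Matrix (Fin N) (Fin R) ℝ} {f : Matrix (Fin T) (Fin R) ℝ}

/-- `C⁽²⁾` is the contribution to the score of the second-order term of the residual. -/
theorem sqrt_mul_score2 (hNT : 0 < (N : ℝ) * T) (X e : Matrix (Fin N) (Fin T) ℝ) :
    √((N : ℝ) * T) * score2 lam f X e =
      -(Xᵀ * quadTerm lam f ((lamᵀ * lam)⁻¹ * lamᵀ) (f * (fᵀ * f)⁻¹) e e).trace := by
  have h0 : √((N : ℝ) * T) ≠ 0 := (Real.sqrt_pos.2 hNT).ne'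
  rw [score2, mul_neg, mul_inv_cancel_left₀ h0]
  have hl : ((lamᵀ * lam)⁻¹)ᵀ = (lamᵀ * lam)⁻¹ := by
    rw [transpose_nonsing_inv, transpose_mul, transpose_transpose]
  have hf : ((fᵀ * f)⁻¹)ᵀ = (fᵀ * f)⁻¹ := by
    rw [transpose_nonsing_inv, transpose_mul, transpose_transpose]
  generalize (lamᵀ * lam)⁻¹ = A at *
  generalize (fᵀ * f)⁻¹ = B at *
  have t1 : (Xᵀ * (annih lam * (e * (annih f * (eᵀ * (lam * A)))) * (B * fᵀ))).trace =
      (e * annih f * eᵀ * annih lam * X * f * B * A * lamᵀ).trace := by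
    rw [← trace_transpose]
    simp only [transpose_mul, transpose_transpose, annih_transpose, hl, hf]
    calc _ = ((f * B * A * lamᵀ) * (e * annih f * eᵀ * annih lam * X)).trace := by
          simp only [Matrix.mul_assoc]
      _ = _ := by rw [trace_mul_comm]; simp only [Matrix.mul_assoc]
  have t2 : (Xᵀ * ((lam * A) * ((B * fᵀ) * (eᵀ * (annih lam * (e * annih f)))))).trace =
      (eᵀ * annih lam * e * annih f * Xᵀ * lam * A * B * fᵀ).trace := by
    calc _ = ((Xᵀ * lam * A * B * fᵀ) * (eᵀ * annih lam * e * annih f)).trace := by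
          simp only [Matrix.mul_assoc]
      _ = _ := by rw [trace_mul_comm]; simp only [Matrix.mul_assoc]
  have t3 : (Xᵀ * (annih lam * (e * (f * B)) * ((A * lamᵀ) * (e * annih f)))).trace =
      (eᵀ * annih lam * X * annih f * eᵀ * lam * A * B * fᵀ).trace := by
    rw [← trace_transpose]
    simp only [transpose_mul, transpose_transpose, annih_transpose, hl, hf]
    calc _ = ((annih f * eᵀ * lam * A * B * fᵀ) * (eᵀ * annih lam * X)).trace := by
          simp only [Matrix.mul_assoc]
      _ = _ := by rw [trace_mul_comm]; simp only [Matrix.mul_assoc]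
  have hLt : (A * lamᵀ)ᵀ = lam * A := by rw [transpose_mul, transpose_transpose, hl]
  have hFt : (f * B)ᵀ = B * fᵀ := by rw [transpose_mul, hf]
  rw [quadTerm, hLt, hFt, Matrix.mul_add, Matrix.mul_add, trace_add, trace_add, t1, t2, t3]

theorem sqrt_mul_score1 (hNT : 0 < (N : ℝ) * T) (X e : Matrix (Fin N) (Fin T) ℝ) :
    √((N : ℝ) * T) * score1 lam f X e = (Xᵀ * (annih lam * (e * annih f))).trace := by
  rw [score1, mul_inv_cancel_left₀ (Real.sqrt_pos.2 hNT).ne', ← trace_transpose]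
  simp only [transpose_mul, transpose_transpose, annih_transpose, Matrix.mul_assoc]

theorem mul_hessW_mulVec (hNT : 0 < (N : ℝ) * T) (X : Fin K → Matrix (Fin N) (Fin T) ℝ)
    (d : EuclideanSpace ℝ (Fin K)) (k : Fin K) :
    (N : ℝ) * T * (hessW lam f X *ᵥ d.ofLp) k =
      ((X k)ᵀ * (annih lam * (lincomb d X * annih f))).trace := by
  simp only [mulVec, dotProduct, Finset.mul_sum, hessW, of_apply, lincomb, Matrix.sum_mul,
    Matrix.mul_sum, trace_sum]
  refine Finset.sum_congr rfl fun j _ => ?_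
  have h1 : (annih f * (X k)ᵀ * annih lam * X j).trace =
      ((X k)ᵀ * (annih lam * (X j * annih f))).trace := by
    rw [Matrix.mul_assoc, Matrix.mul_assoc, trace_mul_comm]
    simp only [Matrix.mul_assoc]
  rw [h1, Matrix.smul_mul, Matrix.mul_smul, Matrix.mul_smul, trace_smul, smul_eq_mul, ← mul_assoc,
    mul_inv_cancel_left₀ hNT.ne', mul_comm]

/-- In the gradient of the remainder the terms of first order in the perturbation
`E = e - (β - β⁰)·X`, and those of second order in `e`, cancel. -/
theorem gradient_remainder_apply (hNT : 0 < (N : ℝ) * T) (X : Fin K → Matrix (Fin N) (Fin T) ℝ)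
    (e Z : Matrix (Fin N) (Fin T) ℝ) (d : EuclideanSpace ℝ (Fin K)) (k : Fin K) :
    (((N : ℝ) * T) • ((WithLp.toLp 2 fun k => -(2 * ((N : ℝ) * T)⁻¹ * ((X k)ᵀ * Z).trace)) -
      ((2 : ℝ) • WithLp.toLp 2 (hessW lam f X *ᵥ d.ofLp)
        - (2 / √((N : ℝ) * T)) • scoreC lam f X e)) : EuclideanSpace ℝ (Fin K)) k =
    -2 * ((X k)ᵀ * (Z - (annih lam * ((e - lincomb d X) * annih f) -
        quadTerm lam f ((lamᵀ * lam)⁻¹ * lamᵀ) (f * (fᵀ * f)⁻¹)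
          (e - lincomb d X) (e - lincomb d X)))).trace
      + 2 * (((X k)ᵀ * quadTerm lam f ((lamᵀ * lam)⁻¹ * lamᵀ) (f * (fᵀ * f)⁻¹)
          (e - lincomb d X) (e - lincomb d X)).trace
        - ((X k)ᵀ * quadTerm lam f ((lamᵀ * lam)⁻¹ * lamᵀ) (f * (fᵀ * f)⁻¹) e e).trace) := by
  have h1 := sqrt_mul_score1 (lam := lam) (f := f) hNT (X k) e
  have h2 := sqrt_mul_score2 (lam := lam) (f := f) hNT (X k) e
  have h3 := mul_hessW_mulVec (lam := lam) (f := f) hNT X d k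
  have hs : (N : ℝ) * T * (2 / √((N : ℝ) * T)) = 2 * √((N : ℝ) * T) := by
    have h0 : √((N : ℝ) * T) ≠ 0 := (Real.sqrt_pos.2 hNT).ne'
    field_simp
    exact (Real.sq_sqrt hNT.le).symm
  have h4 : (((N : ℝ) * T) • ((WithLp.toLp 2 fun k =>
        -(2 * ((N : ℝ) * T)⁻¹ * ((X k)ᵀ * Z).trace)) -
      ((2 : ℝ) • WithLp.toLp 2 (hessW lam f X *ᵥ d.ofLp)
        - (2 / √((N : ℝ) * T)) • scoreC lam f X e)) : EuclideanSpace ℝ (Fin K)) k =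
      -(2 * ((N : ℝ) * T * ((N : ℝ) * T)⁻¹ * ((X k)ᵀ * Z).trace))
      - 2 * ((N : ℝ) * T * (hessW lam f X *ᵥ d.ofLp) k)
      + (N : ℝ) * T * (2 / √((N : ℝ) * T)) * (score1 lam f (X k) e + score2 lam f (X k) e) := by
    simp only [scoreC, PiLp.smul_apply, PiLp.sub_apply, smul_eq_mul]
    ring
  rw [h4, hs, h3, mul_inv_cancel₀ hNT.ne', one_mul, mul_assoc 2 √_, mul_add √_, h1, h2]
  simp only [Matrix.mul_sub, Matrix.sub_mul, trace_sub]
  ring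

theorem quadTerm_self_sub (Lam : Matrix (Fin R) (Fin N) ℝ) (F : Matrix (Fin T) (Fin R) ℝ)
    (e H : Matrix (Fin N) (Fin T) ℝ) :
    quadTerm lam f Lam F (e - H) (e - H) - quadTerm lam f Lam F e e =
      -(quadTerm lam f Lam F (e - H) H + quadTerm lam f Lam F H e) := by
  simp only [quadTerm, Matrix.mul_sub, Matrix.sub_mul, transpose_sub]
  abel

/-- The orders of magnitude: `a = √(NT)`, `s = ‖e‖`, `x = ‖β - β⁰‖`, `y` bounds the perturbation
`(β - β⁰)·X`, `q` the inverse of the singular values of `λf'`, and `φ` is the Frobenius norm of a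
regressor. The first term on the left is the third-order error, the others are the second-order
terms that involve `β - β⁰`. -/
theorem remainder_scalar_bound {c B H γ a x s y r φ q : ℝ} (hc : 0 < c)
    (hH0 : 0 ≤ H) (hγ : 0 < γ) (hγ1 : γ ≤ 1) (ha0 : 0 < a) (hx0 : 0 ≤ x) (hb : x ≤ γ) (hs0 : 0 ≤ s)
    (he : s ^ 3 ≤ γ ^ 3 * a ^ 2) (hy : y = H * a * x) (hsy : s + y ≤ γ * (1 + H) * a)
    (hr : 0 ≤ r) (hφ0 : 0 ≤ φ) (hφ : φ ≤ B * a) (hq : q = 1 / (c * a)) :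
    2 * (r * φ * (50 * q ^ 2 * (s + y) ^ 3))
      + 2 * (r * φ * (3 * q * (s + y) * y) + r * φ * (3 * q * y * s)) ≤
      2 * (r * B) * (200 * (1 + H ^ 3) / c ^ 2 + 6 * H * (1 + H) / c) * γ *
        (a * (1 + a * x)) := by
  have hy0 : 0 ≤ y := by rw [hy]; positivity
  have hcube : (s + y) ^ 3 ≤ 4 * (γ * (1 + H ^ 3)) * (a ^ 2 * (1 + a * x)) := by
    have h1 : (s + y) ^ 3 ≤ 4 * (s ^ 3 + y ^ 3) := by
      nlinarith [mul_nonneg (add_nonneg hs0 hy0) (sq_nonneg (s - y))]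
    have h2 : s ^ 3 ≤ γ * a ^ 2 :=
      he.trans (mul_le_mul_of_nonneg_right (pow_le_of_le_one hγ.le hγ1 (by norm_num))
        (by positivity))
    have h3 : y ^ 3 ≤ γ * H ^ 3 * (a ^ 2 * (a * x)) := by
      have : x ^ 3 ≤ γ * x := by
        have h4 : x * x ≤ γ * 1 := mul_le_mul hb (hb.trans hγ1) hx0 hγ.le
        nlinarith
      calc y ^ 3 = H ^ 3 * a ^ 3 * x ^ 3 := by rw [hy]; ring
        _ ≤ H ^ 3 * a ^ 3 * (γ * x) := mul_le_mul_of_nonneg_left this (by positivity)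
        _ = _ := by ring
    have h5 : 0 ≤ γ * (a ^ 2 * (a * x)) := by positivity
    have h6 : 0 ≤ γ * H ^ 3 * a ^ 2 := by positivity
    linarith
  have hfirst : 50 * q ^ 2 * (s + y) ^ 3 ≤ 200 * (1 + H ^ 3) / c ^ 2 * (γ * (1 + a * x)) := by
    calc 50 * q ^ 2 * (s + y) ^ 3
        ≤ 50 * q ^ 2 * (4 * (γ * (1 + H ^ 3)) * (a ^ 2 * (1 + a * x))) :=
          mul_le_mul_of_nonneg_left hcube (by positivity)
      _ = _ := by rw [hq]; field_simp; ring
  have hsecond : 3 * q * (s + y) * y + 3 * q * y * s ≤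
      6 * H * (1 + H) / c * (γ * (1 + a * x)) := by
    have hq0 : 0 ≤ q := by rw [hq]; positivity
    have h1 : (s + y) * y + y * s ≤ 2 * (γ * (1 + H) * a) * y := by
      nlinarith [mul_le_mul_of_nonneg_right hsy hy0, mul_nonneg hy0 hy0]
    calc _ = 3 * q * ((s + y) * y + y * s) := by ring
      _ ≤ 3 * q * (2 * (γ * (1 + H) * a) * y) := mul_le_mul_of_nonneg_left h1 (by positivity)
      _ = 6 * H * (1 + H) / c * (γ * (a * x)) := by rw [hy, hq]; field_simp; ring
      _ ≤ _ := by gcongr; linarith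
  have hrφ : r * φ ≤ r * (B * a) := mul_le_mul_of_nonneg_left hφ hr
  have hrφ0 : 0 ≤ r * φ := mul_nonneg hr hφ0
  calc _ = 2 * (r * φ) * (50 * q ^ 2 * (s + y) ^ 3
        + (3 * q * (s + y) * y + 3 * q * y * s)) := by ring
    _ ≤ 2 * (r * φ) * (200 * (1 + H ^ 3) / c ^ 2 * (γ * (1 + a * x))
        + 6 * H * (1 + H) / c * (γ * (1 + a * x))) := by gcongr
    _ ≤ 2 * (r * (B * a)) * (200 * (1 + H ^ 3) / c ^ 2 * (γ * (1 + a * x))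
        + 6 * H * (1 + H) / c * (γ * (1 + a * x))) := by gcongr
    _ = _ := by ring

/-- The bound on the gradient of the remainder: `γ` measures both the noise level,
`‖e‖³ ≤ γ³NT`, and the distance from the true parameter. -/
theorem exists_norm_gradient_remainder_le (K R : ℕ) {c B : ℝ} (hc : 0 < c) (hB : 0 < B) :
    ∃ C γ₀ : ℝ, 0 ≤ C ∧ 0 < γ₀ ∧ ∀ γ, 0 < γ → γ ≤ γ₀ → ∀ (N T : ℕ), 0 < N → 0 < T →
      ∀ (lam : Matrix (Fin N) (Fin R) ℝ) (f : Matrix (Fin T) (Fin R) ℝ)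
        (X : Fin K → Matrix (Fin N) (Fin T) ℝ) (e Y : Matrix (Fin N) (Fin T) ℝ)
        (b₀ b : EuclideanSpace ℝ (Fin K)),
      Y = lincomb b₀ X + lam * fᵀ + e →
      (∀ x, c * N * (x ⬝ᵥ x) ≤ x ⬝ᵥ ((lamᵀ * lam) *ᵥ x)) →
      (∀ x, c * T * (x ⬝ᵥ x) ≤ x ⬝ᵥ ((fᵀ * f) *ᵥ x)) →
      (∀ k, frob (X k) ≤ B * √((N : ℝ) * T)) →
      ‖e‖ ^ 3 ≤ γ ^ 3 * ((N : ℝ) * T) → ‖b - b₀‖ ≤ γ →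
      DifferentiableAt ℝ (profileObjective R Y X) b ∧
        ‖∇ (remainder Y X lam f e b₀) b‖ ≤
          C * γ * (√((N : ℝ) * T) * (1 + √((N : ℝ) * T) * ‖b - b₀‖)) := by
  set H := K * B with hH
  have hH0 : 0 ≤ H := by positivity
  refine ⟨K * (2 * (√R * B) * (200 * (1 + H ^ 3) / c ^ 2 + 6 * H * (1 + H) / c)),
    min 1 (c / (37 * (1 + H))), by positivity, by positivity, ?_⟩
  intro γ hγ hγ0 N T hN hT lam f X e Y b₀ b hY hlam hf hX he hb
  have hγ1 : γ ≤ 1 := hγ0.trans (min_le_left _ _)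
  have hγ2 : γ * (37 * (1 + H)) ≤ c := by
    have := hγ0.trans (min_le_right _ _)
    rwa [le_div_iff₀ (by positivity)] at this
  have hNR : (1 : ℝ) ≤ N := by exact_mod_cast hN
  have hTR : (1 : ℝ) ≤ T := by exact_mod_cast hT
  have hNT : 0 < (N : ℝ) * T := by positivity
  obtain ⟨a, ha⟩ : ∃ a, a = √((N : ℝ) * T) := ⟨_, rfl⟩
  have ha1 : 1 ≤ a := by
    rw [ha]; exact Real.one_le_sqrt.2 (by nlinarith)
  have ha2 : (N : ℝ) * T = a ^ 2 := by rw [ha, Real.sq_sqrt hNT.le]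
  have ha0 : 0 < a := by linarith
  obtain ⟨hfac, hL, hF⟩ := exists_factorInverse (s := c * N) (t := c * T) (by positivity)
    (by positivity) hlam hf
  set l := (√(c * N))⁻¹ with hl
  set p := (√(c * T))⁻¹ with hp
  have hlp : l * p = 1 / (c * a) := by
    rw [hl, hp, ← mul_inv, ← Real.sqrt_mul (by positivity),
      show c * N * (c * T) = (c * a) ^ 2 by rw [mul_pow, ← ha2]; ring,
      Real.sqrt_sq (by positivity), one_div]
  set x := ‖b - b₀‖ with hx
  have hx0 : 0 ≤ x := norm_nonneg _
  set s := ‖e‖ with hs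
  have hs0 : 0 ≤ s := norm_nonneg _
  obtain ⟨Δ, hΔ⟩ : ∃ Δ, Δ = lincomb (b - b₀) X := ⟨_, rfl⟩
  set y := H * a * x with hy
  have hy0 : 0 ≤ y := by positivity
  have hΔy : ‖Δ‖ ≤ y := by
    rw [hΔ]
    refine (opNorm_lincomb_le _ _).trans ?_
    have : ∑ k, ‖X k‖ ≤ ∑ _k : Fin K, B * a := Finset.sum_le_sum fun k _ =>
      (opNorm_le_frob _).trans (ha ▸ hX k)
    rw [Finset.sum_const, Finset.card_univ, Fintype.card_fin, nsmul_eq_mul] at this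
    calc _ ≤ x * (K * (B * a)) := mul_le_mul_of_nonneg_left this hx0
      _ = y := by rw [hy, hH]; ring
  -- the noise is of smaller order than the singular values of `λf'`, which are of order `a`
  have hsa : s ≤ γ * a := by
    rw [ha2] at he
    have : s ^ 3 ≤ (γ * a) ^ 3 := by
      rw [mul_pow]
      refine he.trans (mul_le_mul_of_nonneg_left ?_ (by positivity))
      exact pow_le_pow_right₀ ha1 (by norm_num)
    exact le_of_pow_le_pow_left₀ (by norm_num) (by positivity) this
  have hya : y ≤ γ * H * a := by
    rw [hy]
    have := mul_le_mul_of_nonneg_left hb (show 0 ≤ H * a by positivity)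
    linarith
  have hEn : ‖e - Δ‖ ≤ s + y := (norm_sub_le _ _).trans (by linarith)
  have hsy : s + y ≤ γ * (1 + H) * a := by linarith
  have hsmall : 36 * (l * p * (s + y)) < 1 := by
    rw [hlp, one_div, inv_mul_eq_div, mul_div_assoc', div_lt_one (by positivity)]
    have h1 : γ * (1 + H) * 37 * a ≤ c * a := mul_le_mul_of_nonneg_right (by linarith) ha0.le
    have h2 : 0 < γ * (1 + H) * a := by positivity
    linarith
  have hlp0 : 0 ≤ l * p := by rw [hlp]; positivity
  have hsmall' : 36 * (l * p * ‖e - lincomb (b - b₀) X‖) < 1 := by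
    rw [← hΔ]
    refine lt_of_le_of_lt ?_ hsmall
    exact mul_le_mul_of_nonneg_left (mul_le_mul_of_nonneg_left hEn hlp0) (by norm_num)
  obtain ⟨Z, D, Xi, hres, hZ, hgrad⟩ := hfac.exists_hasGradientAt_profile hY hL hF hsmall'
  refine ⟨hgrad.differentiableAt, ?_⟩
  rw [(hasGradientAt_remainder hgrad lam f e b₀).gradient]
  refine (norm_le_sum_abs _).trans ?_
  have hcomp : ∀ k, 2 * (√R * frob (X k) * (50 * (l * p) ^ 2 * (s + y) ^ 3))
      + 2 * (√R * frob (X k) * (3 * (l * p) * (s + y) * y)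
        + √R * frob (X k) * (3 * (l * p) * y * s)) ≤
      2 * (√R * B) * (200 * (1 + H ^ 3) / c ^ 2 + 6 * H * (1 + H) / c) * γ *
        (a * (1 + a * x)) := fun k =>
    remainder_scalar_bound hc hH0 hγ hγ1 ha0 hx0 hb hs0 (ha2 ▸ he) hy hsy
      (Real.sqrt_nonneg _) (frob_nonneg _) (ha ▸ hX k) hlp
  have hsum : ∀ k, |(((N : ℝ) * T) • ((WithLp.toLp 2 fun k =>
        -(2 * ((N : ℝ) * T)⁻¹ * ((X k)ᵀ * Z).trace)) -
      ((2 : ℝ) • WithLp.toLp 2 (hessW lam f X *ᵥ (b - b₀).ofLp)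
        - (2 / √((N : ℝ) * T)) • scoreC lam f X e)) : EuclideanSpace ℝ (Fin K)) k| ≤
      2 * (√R * B) * (200 * (1 + H ^ 3) / c ^ 2 + 6 * H * (1 + H) / c) * γ *
        (a * (1 + a * x)) := by
    intro k
    refine le_trans ?_ (hcomp k)
    rw [gradient_remainder_apply hNT, ← hΔ, ← trace_sub, ← Matrix.mul_sub, quadTerm_self_sub,
      Matrix.mul_neg, trace_neg, Matrix.mul_add, trace_add]
    rw [← hΔ] at hres hZ
    have b1 := hres.abs_trace_sub_le (X k) hL hF hEn (hZ.trans hEn) (by linarith)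
    have b2 := abs_trace_quadTerm_le (lam := lam) (f := f) (X k) hL hF hEn hΔy
    have b3 := abs_trace_quadTerm_le (lam := lam) (f := f) (X k) hL hF hΔy hs.ge
    have c1 := abs_le.1 b1
    have c2 := abs_le.1 b2
    have c3 := abs_le.1 b3
    rw [abs_le]
    constructor <;> linarith
  calc _ ≤ ∑ _k : Fin K, 2 * (√R * B) * (200 * (1 + H ^ 3) / c ^ 2 + 6 * H * (1 + H) / c) * γ *
        (a * (1 + a * x)) := Finset.sum_le_sum fun k _ => hsum k
    _ = _ := by
      rw [Finset.sum_const, Finset.card_univ, Fintype.card_fin, nsmul_eq_mul, ← ha]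
      ring

end Deterministic

/-! ### Events of probability approaching one -/

section Probability

variable {Ω : Type*} [MeasurableSpace Ω] {P : Measure Ω}

theorem exists_measure_compl_le [IsFiniteMeasure P] {G : ℕ → Set Ω}
    (hG : ∀ m, MeasurableSet (G m)) (hmono : Monotone G) (hae : ∀ᵐ ω ∂P, ∃ m, ω ∈ G m)
    {δ : ℝ≥0∞} (hδ : 0 < δ) : ∃ m, P (G m)ᶜ ≤ δ := by
  have h1 : Tendsto (fun m => P (G m)ᶜ) atTop (𝓝 (P (⋂ m, (G m)ᶜ))) :=
    tendsto_measure_iInter_atTop (fun m => (hG m).compl.nullMeasurableSet)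
      (fun i j hij => Set.compl_subset_compl.2 (hmono hij)) ⟨0, measure_ne_top _ _⟩
  have h2 : P (⋂ m, (G m)ᶜ) = 0 := by
    rw [← Set.compl_iUnion, measure_eq_zero_iff_ae_notMem]
    filter_upwards [hae] with ω hω
    simpa using hω
  rw [h2] at h1
  exact ((ENNReal.tendsto_nhds_zero.1 h1 δ hδ)).exists

theorem eventually_measure_entry_le {d : ℕ} {A : ℕ → Ω → Matrix (Fin d) (Fin d) ℝ}
    {S : Ω → Matrix (Fin d) (Fin d) ℝ}
    (hconv : ∀ i j, TendstoInMeasure P (fun n ω => A n ω i j) atTop (fun ω => S ω i j))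
    {r : ℝ} (hr : 0 < r) {δ : ℝ≥0∞} (hδ : 0 < δ) :
    ∀ᶠ n in atTop, P {ω | ¬ ∀ i j, |A n ω i j - S ω i j| < r} ≤ δ := by
  have h1 : Tendsto (fun n => ∑ p : Fin d × Fin d,
      P {ω | r ≤ ‖A n ω p.1 p.2 - S ω p.1 p.2‖}) atTop (𝓝 0) := by
    have := tendsto_finsetSum (Finset.univ : Finset (Fin d × Fin d)) fun p _ =>
      tendstoInMeasure_iff_norm.1 (hconv p.1 p.2) r hr
    simpa using this
  filter_upwards [ENNReal.tendsto_nhds_zero.1 h1 δ hδ] with n hn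
  refine (measure_mono ?_).trans ((measure_biUnion_finset_le Finset.univ _).trans hn)
  intro ω hω
  simp only [Set.mem_ofPred_eq, not_forall, not_lt] at hω
  obtain ⟨i, j, hij⟩ := hω
  exact Set.mem_biUnion (Finset.mem_coe.2 (Finset.mem_univ (i, j))) hij

theorem exists_pos_le_dotProduct_mulVec {d : ℕ} {S : Matrix (Fin d) (Fin d) ℝ} (hS : S.PosDef) :
    ∃ c : ℝ, 0 < c ∧ ∀ x, c * (x ⬝ᵥ x) ≤ x ⬝ᵥ (S *ᵥ x) := by
  obtain ⟨W, μ, hW1, hW2, hanti, -, hspec⟩ := exists_antitone_spectral hS.posSemidef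
  have hquad : ∀ x, x ⬝ᵥ (S *ᵥ x) = ∑ i, μ i * ((Wᵀ *ᵥ x) i * (Wᵀ *ᵥ x) i) := by
    intro x
    rw [hspec, Matrix.mul_assoc, ← transpose_transpose W, ← mulVec_dotProduct_mulVec,
      transpose_transpose, ← mulVec_mulVec]
    simp only [dotProduct, mulVec_diagonal]
    exact Finset.sum_congr rfl fun j _ => by ring
  have hμ : ∀ i, 0 < μ i := by
    intro i
    have h1 : Wᵀ *ᵥ (W *ᵥ Pi.single i 1) = Pi.single i 1 := by
      rw [mulVec_mulVec, hW1, one_mulVec]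
    have h0 : W *ᵥ Pi.single i (1 : ℝ) ≠ 0 := by
      intro h
      rw [h, mulVec_zero] at h1
      have := congrFun h1 i
      simp at this
    have h2 := hS.dotProduct_mulVec_pos h0
    rw [star_trivial, hquad, h1] at h2
    simpa [Pi.single_apply] using h2
  obtain ⟨c, hc, hcμ⟩ : ∃ c : ℝ, 0 < c ∧ ∀ i, c ≤ μ i := by
    rcases Nat.eq_zero_or_pos d with rfl | hd
    · exact ⟨1, one_pos, fun i => i.elim0⟩
    · exact ⟨μ ⟨d - 1, by omega⟩, hμ _, fun i => hanti (Fin.le_def.2 (by simp; omega))⟩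
  refine ⟨c, hc, fun x => ?_⟩
  have hx : x ⬝ᵥ x = (Wᵀ *ᵥ x) ⬝ᵥ (Wᵀ *ᵥ x) := by
    rw [mulVec_dotProduct_mulVec, transpose_transpose, hW2, one_mulVec]
  rw [hquad, hx, dotProduct, Finset.mul_sum]
  exact Finset.sum_le_sum fun i _ => mul_le_mul_of_nonneg_right (hcμ i) (mul_self_nonneg _)

/-- Small entries make a small quadratic form. -/
theorem abs_dotProduct_mulVec_le {d : ℕ} {D : Matrix (Fin d) (Fin d) ℝ} {r : ℝ}
    (hD : ∀ i j, |D i j| ≤ r) (x : Fin d → ℝ) : |x ⬝ᵥ (D *ᵥ x)| ≤ r * d * (x ⬝ᵥ x) := by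
  rcases Nat.eq_zero_or_pos d with rfl | hd
  · simp
  have hr : 0 ≤ r := (abs_nonneg _).trans (hD ⟨0, hd⟩ ⟨0, hd⟩)
  have h1 : |x ⬝ᵥ (D *ᵥ x)| ≤ ∑ i, ∑ j, r * (|x i| * |x j|) := by
    simp only [dotProduct, mulVec, Finset.mul_sum]
    refine (Finset.abs_sum_le_sum_abs _ _).trans (Finset.sum_le_sum fun i _ => ?_)
    refine (Finset.abs_sum_le_sum_abs _ _).trans (Finset.sum_le_sum fun j _ => ?_)
    rw [abs_mul, abs_mul]
    have := mul_le_mul_of_nonneg_right (hD i j) (mul_nonneg (abs_nonneg (x i)) (abs_nonneg (x j)))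
    linarith
  have h2 : ∑ i, ∑ j, r * (|x i| * |x j|) = r * (∑ i, |x i|) ^ 2 := by
    rw [sq, Finset.sum_mul_sum, Finset.mul_sum]
    simp only [Finset.mul_sum]
  have h3 : (∑ i, |x i|) ^ 2 ≤ d * (x ⬝ᵥ x) := by
    have := sq_sum_le_card_mul_sum_sq (s := Finset.univ) (f := fun i => |x i|)
    simpa [dotProduct, sq] using this
  rw [h2] at h1
  refine h1.trans ((mul_le_mul_of_nonneg_left h3 hr).trans (le_of_eq ?_))
  ring

/-- With probability close to one the matrices are bounded below, uniformly along the sequence,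
although their limit may be random. -/
theorem PlimPosDef.exists_lower_bound [IsFiniteMeasure P] {d : ℕ}
    {A : ℕ → Ω → Matrix (Fin d) (Fin d) ℝ} (h : PlimPosDef P A) {δ : ℝ≥0∞} (hδ : 0 < δ) :
    ∃ c : ℝ, 0 < c ∧
      ∀ᶠ n in atTop, P {ω | ¬ ∀ x, c * (x ⬝ᵥ x) ≤ x ⬝ᵥ (A n ω *ᵥ x)} ≤ δ := by
  obtain ⟨S, hmeas, hconv, hpos⟩ := h
  have hδ2 : 0 < δ / 2 := ENNReal.half_pos hδ.ne'
  set G : ℕ → Set Ω := fun m => {ω | ∀ x, ((m : ℝ) + 1)⁻¹ * (x ⬝ᵥ x) ≤ x ⬝ᵥ (S ω *ᵥ x)} with hG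
  have hSm : Measurable fun ω i j => S ω i j :=
    measurable_pi_iff.2 fun i => measurable_pi_iff.2 fun j => hmeas i j
  have hGm : ∀ m, MeasurableSet (G m) := by
    intro m
    -- the preimage of a closed set of matrices
    have hcl : IsClosed {B : Fin d → Fin d → ℝ |
        ∀ x : Fin d → ℝ, ((m : ℝ) + 1)⁻¹ * (x ⬝ᵥ x) ≤ x ⬝ᵥ (Matrix.of B *ᵥ x)} := by
      rw [Set.ofPred_forall]
      refine isClosed_iInter fun x => isClosed_le continuous_const ?_
      simp only [dotProduct, mulVec, of_apply]
      fun_prop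
    exact hSm hcl.measurableSet
  have hmono : Monotone G := by
    intro m m' hm ω hω x
    refine le_trans (mul_le_mul_of_nonneg_right ?_ ?_) (hω x)
    · have : (m : ℝ) ≤ m' := by exact_mod_cast hm
      gcongr
    · exact dotProduct_self_nonneg_real _
  have hae : ∀ᵐ ω ∂P, ∃ m, ω ∈ G m := by
    filter_upwards [hpos] with ω hω
    obtain ⟨c, hc, hcx⟩ := exists_pos_le_dotProduct_mulVec hω
    obtain ⟨m, hm⟩ := exists_nat_one_div_lt hc
    refine ⟨m, fun x => le_trans (mul_le_mul_of_nonneg_right ?_ ?_) (hcx x)⟩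
    · rw [← one_div]; exact hm.le
    · exact dotProduct_self_nonneg_real _
  obtain ⟨m, hm⟩ := exists_measure_compl_le hGm hmono hae hδ2
  set c : ℝ := ((m : ℝ) + 1)⁻¹ with hc
  have hc0 : 0 < c := by positivity
  refine ⟨c / 2, by positivity, ?_⟩
  have hr : 0 < c / (2 * (d + 1)) := by positivity
  filter_upwards [eventually_measure_entry_le hconv hr hδ2] with n hn
  refine (measure_mono ?_).trans ((measure_union_le (G m)ᶜ
    {ω | ¬ ∀ i j, |A n ω i j - S ω i j| < c / (2 * (d + 1))}).trans
    ((add_le_add hm hn).trans (ENNReal.add_halves δ).le))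
  intro ω hω
  by_contra hcon
  rw [Set.mem_union, not_or, Set.notMem_compl_iff] at hcon
  obtain ⟨hω1, hω2⟩ := hcon
  rw [Set.mem_ofPred_eq, not_not] at hω2
  refine hω fun x => ?_
  have h1 := hω1 x
  have h2 := abs_dotProduct_mulVec_le (D := A n ω - S ω) (r := c / (2 * (d + 1)))
    (fun i j => (hω2 i j).le) x
  rw [sub_mulVec, dotProduct_sub] at h2
  have h3 : 0 ≤ x ⬝ᵥ x := dotProduct_self_nonneg_real x
  have h4 : c / (2 * (d + 1)) * d ≤ c / 2 := by
    rw [div_mul_eq_mul_div, div_le_div_iff₀ (by positivity) (by norm_num)]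
    nlinarith
  have h5 := mul_le_mul_of_nonneg_right h4 h3
  have h6 := (abs_le.1 h2).1
  linarith

/-- With probability close to one the diagonal entries are bounded above, uniformly along the
sequence. -/
theorem PlimPosDef.exists_diag_bound [IsFiniteMeasure P] {d : ℕ}
    {A : ℕ → Ω → Matrix (Fin d) (Fin d) ℝ} (h : PlimPosDef P A) {δ : ℝ≥0∞} (hδ : 0 < δ) :
    ∃ B : ℝ, 0 < B ∧ ∀ᶠ n in atTop, P {ω | ¬ ∀ i, A n ω i i ≤ B} ≤ δ := by
  obtain ⟨S, hmeas, hconv, -⟩ := h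
  have hδ2 : 0 < δ / 2 := ENNReal.half_pos hδ.ne'
  obtain ⟨m, hm⟩ := exists_measure_compl_le (P := P)
    (G := fun m : ℕ => {ω | ∀ i, S ω i i ≤ m})
    (fun m => by
      rw [Set.ofPred_forall]
      exact MeasurableSet.iInter fun i => measurableSet_le (hmeas i i) measurable_const)
    (fun m m' hm ω hω i => (hω i).trans (by exact_mod_cast hm))
    (Eventually.of_forall fun ω => by
      obtain ⟨m, hm⟩ := exists_nat_ge (∑ i, |S ω i i|)
      refine ⟨m, fun i => (le_abs_self _).trans (le_trans ?_ hm)⟩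
      exact Finset.single_le_sum (f := fun i => |S ω i i|) (fun _ _ => abs_nonneg _)
        (Finset.mem_univ i)) hδ2
  refine ⟨m + 1, by positivity, ?_⟩
  filter_upwards [eventually_measure_entry_le hconv one_pos hδ2] with n hn
  refine (measure_mono ?_).trans ((measure_union_le {ω | ∀ i, S ω i i ≤ m}ᶜ
    {ω | ¬ ∀ i j, |A n ω i j - S ω i j| < 1}).trans
    ((add_le_add hm hn).trans (ENNReal.add_halves δ).le))
  intro ω hω
  by_contra hcon
  rw [Set.mem_union, not_or, Set.notMem_compl_iff] at hcon
  obtain ⟨hω1, hω2⟩ := hcon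
  rw [Set.mem_ofPred_eq, not_not] at hω2
  refine hω fun i => ?_
  have h1 := hω1 i
  have h2 := (abs_lt.1 (hω2 i i)).2
  linarith

/-- `‖e‖ = o_p(N^{2/3})` and `N ∼ κ²T` make `‖e‖³` small compared to `NT`. -/
theorem eventually_measure_noise_le {N T : ℕ → ℕ}
    {e : (n : ℕ) → Ω → Matrix (Fin (N n)) (Fin (T n)) ℝ}
    (hN : Tendsto N atTop atTop) (hT : Tendsto T atTop atTop) {κ : ℝ} (hκ : 0 < κ)
    (hNT : Tendsto (fun n => (N n : ℝ) / (T n : ℝ)) atTop (𝓝 (κ ^ 2)))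
    (he : TendstoInMeasure P (fun n ω => specNorm (e n ω) / (N n : ℝ) ^ (2 / 3 : ℝ)) atTop
      (fun _ => (0 : ℝ)))
    {γ : ℝ} (hγ : 0 < γ) {δ : ℝ≥0∞} (hδ : 0 < δ) :
    ∀ᶠ n in atTop, P {ω | ¬ specNorm (e n ω) ^ 3 ≤ γ ^ 3 * ((N n : ℝ) * T n)} ≤ δ := by
  set r := γ / (1 + 2 * κ ^ 2) with hr
  have hr0 : 0 < r := by positivity
  have hr3 : r ^ 3 * (2 * κ ^ 2) ≤ γ ^ 3 := by
    rw [hr, div_pow, div_mul_eq_mul_div, div_le_iff₀ (by positivity)]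
    refine mul_le_mul_of_nonneg_left ?_ (by positivity)
    have : 0 < κ ^ 2 := by positivity
    nlinarith [sq_nonneg (κ ^ 2), pow_pos this 3]
  filter_upwards [ENNReal.tendsto_nhds_zero.1 (tendstoInMeasure_iff_norm.1 he r hr0) δ hδ,
    hNT.eventually_lt_const (show κ ^ 2 < 2 * κ ^ 2 by nlinarith [pow_pos hκ 2]),
    hN.eventually_ge_atTop 1, hT.eventually_ge_atTop 1] with n hn hratio hN1 hT1
  refine (measure_mono fun ω hω => ?_).trans hn
  by_contra hcon
  rw [Set.mem_ofPred_eq, not_le, sub_zero, Real.norm_eq_abs] at hcon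
  have hNp : (0 : ℝ) < N n := by exact_mod_cast hN1
  have hTp : (0 : ℝ) < T n := by exact_mod_cast hT1
  have h1 : specNorm (e n ω) ≤ r * (N n : ℝ) ^ (2 / 3 : ℝ) := by
    rw [← div_le_iff₀ (by positivity)]
    exact (le_abs_self _).trans hcon.le
  rw [div_lt_iff₀ hTp] at hratio
  refine hω ?_
  have h2 : ((N n : ℝ) ^ (2 / 3 : ℝ)) ^ 3 = (N n : ℝ) ^ 2 := by
    rw [← Real.rpow_natCast, ← Real.rpow_mul hNp.le]
    norm_num
  calc specNorm (e n ω) ^ 3 ≤ (r * (N n : ℝ) ^ (2 / 3 : ℝ)) ^ 3 :=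
        pow_le_pow_left₀ (norm_nonneg _) h1 3
    _ = r ^ 3 * (N n * N n) := by rw [mul_pow, h2, sq]
    _ ≤ r ^ 3 * (N n * (2 * κ ^ 2 * T n)) := by gcongr
    _ = r ^ 3 * (2 * κ ^ 2) * (N n * T n) := by ring
    _ ≤ _ := by gcongr

open scoped Matrix.Norms.L2Operator in
theorem specNorm_eq_opNorm {m n : ℕ} (A : Matrix (Fin m) (Fin n) ℝ) : specNorm A = ‖A‖ := by
  rw [l2_opNorm_def]; rfl

/-- Outside an event of small probability, the profile objective is differentiable near `β⁰` and
the gradient of the remainder is small. -/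
theorem eventually_measure_gradient_remainder_le [IsFiniteMeasure P]
    (K R : ℕ) (N T : ℕ → ℕ) (β₀ : EuclideanSpace ℝ (Fin K))
    (lam : (n : ℕ) → Ω → Matrix (Fin (N n)) (Fin R) ℝ)
    (f : (n : ℕ) → Ω → Matrix (Fin (T n)) (Fin R) ℝ)
    (X : (n : ℕ) → Ω → Fin K → Matrix (Fin (N n)) (Fin (T n)) ℝ)
    (e : (n : ℕ) → Ω → Matrix (Fin (N n)) (Fin (T n)) ℝ)
    (Y : (n : ℕ) → Ω → Matrix (Fin (N n)) (Fin (T n)) ℝ)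
    (hY : ∀ n ω, Y n ω = lincomb β₀ (X n ω) + lam n ω * (f n ω)ᵀ + e n ω)
    (hN : Tendsto N atTop atTop) (hT : Tendsto T atTop atTop) {κ : ℝ} (hκ : 0 < κ)
    (hNT : Tendsto (fun n => (N n : ℝ) / (T n : ℝ)) atTop (𝓝 (κ ^ 2)))
    (hA_lam : PlimPosDef P fun n ω => (N n : ℝ)⁻¹ • ((lam n ω)ᵀ * lam n ω))
    (hA_f : PlimPosDef P fun n ω => (T n : ℝ)⁻¹ • ((f n ω)ᵀ * f n ω))
    (hA_e : TendstoInMeasure P (fun n ω => specNorm (e n ω) / (N n : ℝ) ^ (2 / 3 : ℝ)) atTop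
      (fun _ => (0 : ℝ)))
    (hA_X : PlimPosDef P fun n ω => Matrix.of fun k l =>
      ((N n : ℝ) * T n)⁻¹ * ∑ i, ∑ t, X n ω k i t * X n ω l i t)
    {η : ℕ → ℝ} (hη : Tendsto η atTop (𝓝 0)) {ε : ℝ} (hε : 0 < ε) {δ : ℝ≥0∞} (hδ : 0 < δ) :
    ∀ᶠ n in atTop, P {ω | ¬ ∀ β, ‖β - β₀‖ ≤ η n →
      DifferentiableAt ℝ (profileObjective R (Y n ω) (X n ω)) β ∧
      ‖∇ (remainder (Y n ω) (X n ω) (lam n ω) (f n ω) (e n ω) β₀) β‖ ≤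
        ε * (√((N n : ℝ) * T n) * (1 + √((N n : ℝ) * T n) * ‖β - β₀‖))} ≤ δ := by
  have hδ2 : 0 < δ / 2 := ENNReal.half_pos hδ.ne'
  have hδ4 : 0 < δ / 2 / 2 := ENNReal.half_pos hδ2.ne'
  obtain ⟨c₁, hc₁, h₁⟩ := hA_lam.exists_lower_bound hδ4
  obtain ⟨c₂, hc₂, h₂⟩ := hA_f.exists_lower_bound hδ4
  obtain ⟨B, hB, h₃⟩ := hA_X.exists_diag_bound hδ4
  obtain ⟨C, γ₀, hC, hγ₀, hdet⟩ :=
    exists_norm_gradient_remainder_le K R (lt_min hc₁ hc₂) (Real.sqrt_pos.2 hB)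
  set γ := min γ₀ (ε / (C + 1)) with hγ
  have hγpos : 0 < γ := lt_min hγ₀ (by positivity)
  have hCγ : C * γ ≤ ε := by
    have h1 : γ * (C + 1) ≤ ε := by
      rw [← le_div_iff₀ (by positivity)]; exact min_le_right _ _
    nlinarith
  filter_upwards [h₁, h₂, h₃, eventually_measure_noise_le hN hT hκ hNT hA_e hγpos hδ4,
    hN.eventually_ge_atTop 1, hT.eventually_ge_atTop 1, hη.eventually_lt_const hγpos]
    with n h₁ h₂ h₃ h₄ hN1 hT1 hηn
  have hNp : (0 : ℝ) < N n := by exact_mod_cast hN1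
  have hTp : (0 : ℝ) < T n := by exact_mod_cast hT1
  have hsum : P (({ω | ¬ ∀ x, c₁ * (x ⬝ᵥ x) ≤
        x ⬝ᵥ (((N n : ℝ)⁻¹ • ((lam n ω)ᵀ * lam n ω)) *ᵥ x)} ∪
      {ω | ¬ ∀ x, c₂ * (x ⬝ᵥ x) ≤ x ⬝ᵥ (((T n : ℝ)⁻¹ • ((f n ω)ᵀ * f n ω)) *ᵥ x)}) ∪
      ({ω | ¬ ∀ k, (Matrix.of fun k l =>
        ((N n : ℝ) * T n)⁻¹ * ∑ i, ∑ t, X n ω k i t * X n ω l i t) k k ≤ B} ∪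
      {ω | ¬ specNorm (e n ω) ^ 3 ≤ γ ^ 3 * ((N n : ℝ) * T n)})) ≤ δ := by
    refine (measure_union_le _ _).trans ?_
    refine (add_le_add ((measure_union_le _ _).trans (add_le_add h₁ h₂))
      ((measure_union_le _ _).trans (add_le_add h₃ h₄))).trans (le_of_eq ?_)
    rw [ENNReal.add_halves, ENNReal.add_halves]
  refine (measure_mono fun ω hω => ?_).trans hsum
  by_contra hcon
  simp only [Set.mem_union, Set.mem_ofPred_eq, not_or, not_not] at hcon
  obtain ⟨⟨g₁, g₂⟩, g₃, g₄⟩ := hcon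
  refine hω fun β hβ => ?_
  have hgram : ∀ {m : ℕ} {A : Matrix (Fin m) (Fin R) ℝ} {c' : ℝ}, 0 < (m : ℝ) →
      min c₁ c₂ ≤ c' → (∀ x, c' * (x ⬝ᵥ x) ≤ x ⬝ᵥ (((m : ℝ)⁻¹ • (Aᵀ * A)) *ᵥ x)) →
      ∀ x, min c₁ c₂ * m * (x ⬝ᵥ x) ≤ x ⬝ᵥ ((Aᵀ * A) *ᵥ x) := by
    intro m A c' hm hc' h x
    have h1 := h x
    rw [smul_mulVec, dotProduct_smul, smul_eq_mul, inv_mul_eq_div, le_div_iff₀ hm] at h1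
    have h0 : 0 ≤ x ⬝ᵥ x := dotProduct_self_nonneg_real x
    have h2 : min c₁ c₂ * (m * (x ⬝ᵥ x)) ≤ c' * (m * (x ⬝ᵥ x)) :=
      mul_le_mul_of_nonneg_right hc' (by positivity)
    linarith
  have hX : ∀ k, frob (X n ω k) ≤ √B * √((N n : ℝ) * T n) := by
    intro k
    have h1 := g₃ k
    rw [of_apply, inv_mul_eq_div, div_le_iff₀ (by positivity)] at h1
    rw [← Real.sqrt_mul hB.le]
    refine Real.sqrt_le_sqrt (le_trans (le_of_eq ?_) h1)
    simp only [sq]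
  rw [specNorm_eq_opNorm] at g₄
  obtain ⟨hd, hg⟩ := hdet γ hγpos (min_le_left _ _) (N n) (T n) hN1 hT1 (lam n ω) (f n ω) (X n ω)
    (e n ω) (Y n ω) β₀ β (hY n ω) (hgram hNp (min_le_left _ _) g₁)
    (hgram hTp (min_le_right _ _) g₂) hX g₄ (hβ.trans hηn.le)
  exact ⟨hd, hg.trans (mul_le_mul_of_nonneg_right hCγ (by positivity))⟩

end Probability

end PanelIFE

end

theorem mainTheorem6
    {Ω : Type*} [MeasurableSpace Ω] (P : Measure Ω) [IsProbabilityMeasure P]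
    (K R : ℕ) (N T : ℕ → ℕ)
    -- the true parameters, the regressors, the errors and the outcomes, along the sequence
    (β₀ : EuclideanSpace ℝ (Fin K))
    (lam : (n : ℕ) → Ω → Matrix (Fin (N n)) (Fin R) ℝ)
    (f : (n : ℕ) → Ω → Matrix (Fin (T n)) (Fin R) ℝ)
    (X : (n : ℕ) → Ω → Fin K → Matrix (Fin (N n)) (Fin (T n)) ℝ)
    (e : (n : ℕ) → Ω → Matrix (Fin (N n)) (Fin (T n)) ℝ)
    (Y : (n : ℕ) → Ω → Matrix (Fin (N n)) (Fin (T n)) ℝ)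
    (hlam : ∀ n i r, Measurable fun ω => lam n ω i r)
    (hf : ∀ n t r, Measurable fun ω => f n ω t r)
    (hX : ∀ n k i t, Measurable fun ω => X n ω k i t)
    (he : ∀ n i t, Measurable fun ω => e n ω i t)
    -- the model
    (hY : ∀ n ω, Y n ω = PanelIFE.lincomb β₀ (X n ω) + lam n ω * (f n ω)ᵀ + e n ω)
    -- `N, T → ∞` with `N / T → κ²`, `0 < κ < ∞`
    (hN : Tendsto N atTop atTop) (hT : Tendsto T atTop atTop)
    (κ : ℝ) (hκ : 0 < κ)
    (hNT : Tendsto (fun n => (N n : ℝ) / (T n : ℝ)) atTop (𝓝 (κ ^ 2)))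
    -- `plim λ⁰'λ⁰ / N > 0` and `plim f⁰'f⁰ / T > 0`
    (hA_lam : PanelIFE.PlimPosDef P fun n ω => (N n : ℝ)⁻¹ • ((lam n ω)ᵀ * lam n ω))
    (hA_f : PanelIFE.PlimPosDef P fun n ω => (T n : ℝ)⁻¹ • ((f n ω)ᵀ * f n ω))
    -- `‖e‖ = o_p(N^{2/3})`
    (hA_e : TendstoInMeasure P
      (fun n ω => PanelIFE.specNorm (e n ω) / (N n : ℝ) ^ (2 / 3 : ℝ)) atTop (fun _ => (0 : ℝ)))
    -- `plim (NT)⁻¹ ∑ᵢ ∑ₜ Xᵢₜ Xᵢₜ' > 0`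
    (hA_X : PanelIFE.PlimPosDef P fun n ω => Matrix.of fun k l =>
      ((N n : ℝ) * T n)⁻¹ * ∑ i, ∑ t, X n ω k i t * X n ω l i t) :
    -- the formula for the score, wherever the score exists
    (∀ n ω β, DifferentiableAt ℝ (PanelIFE.profileObjective R (Y n ω) (X n ω)) β →
      DifferentiableAt ℝ (PanelIFE.remainder (Y n ω) (X n ω) (lam n ω) (f n ω) (e n ω) β₀) β ∧
      ∇ (PanelIFE.profileObjective R (Y n ω) (X n ω)) β =
        (2 : ℝ) • WithLp.toLp 2
            (PanelIFE.hessW (lam n ω) (f n ω) (X n ω) *ᵥ (β - β₀).ofLp)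
          - (2 / √((N n : ℝ) * T n)) •
            PanelIFE.scoreC (lam n ω) (f n ω) (X n ω) (e n ω)
          + ((N n : ℝ) * T n)⁻¹ •
            ∇ (PanelIFE.remainder (Y n ω) (X n ω) (lam n ω) (f n ω) (e n ω) β₀) β) ∧
    ∀ η : ℕ → ℝ, Tendsto η atTop (𝓝 0) →
      -- with probability approaching one the score exists on the whole ball
      PanelIFE.Wpa1 P (fun n ω => ∀ β, ‖β - β₀‖ ≤ η n →
        DifferentiableAt ℝ (PanelIFE.profileObjective R (Y n ω) (X n ω)) β) ∧
      -- the remainder bound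
      PanelIFE.IsLittleOpOne P (fun n ω =>
        ⨆ (β : EuclideanSpace ℝ (Fin K)) (_ : ‖β - β₀‖ ≤ η n),
          ENNReal.ofReal
            (‖∇ (PanelIFE.remainder (Y n ω) (X n ω) (lam n ω) (f n ω) (e n ω) β₀) β‖ /
              (√((N n : ℝ) * T n) * (1 + √((N n : ℝ) * T n) * ‖β - β₀‖)))) := by
  refine ⟨fun n ω β h => PanelIFE.differentiableAt_remainder_and_gradient h _ _ _ _,
    fun η hη => ⟨?_, fun ε hε => ?_⟩⟩
  · refine ENNReal.tendsto_nhds_zero.2 fun δ hδ => ?_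
    filter_upwards [PanelIFE.eventually_measure_gradient_remainder_le K R N T β₀ lam f X e Y hY hN
      hT hκ hNT hA_lam hA_f hA_e hA_X hη one_pos hδ] with n hn
    refine (measure_mono ?_).trans hn
    exact fun ω hω h => hω fun β hβ => (h β hβ).1
  · -- a real number strictly between `0` and `ε`, which may be infinite
    obtain ⟨r, hr0, hrε⟩ := ENNReal.lt_iff_exists_real_btwn.1 hε
    have hr : 0 < r := ENNReal.ofReal_pos.1 hrε.1
    refine ENNReal.tendsto_nhds_zero.2 fun δ hδ => ?_
    filter_upwards [PanelIFE.eventually_measure_gradient_remainder_le K R N T β₀ lam f X e Y hY hN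
      hT hκ hNT hA_lam hA_f hA_e hA_X hη hr hδ] with n hn
    refine (measure_mono ?_).trans hn
    intro ω hω h
    refine absurd (le_trans hω (iSup₂_le fun β hβ => ?_)) (not_le.2 hrε.2)
    refine ENNReal.ofReal_le_ofReal (div_le_of_le_mul₀ (by positivity) hr.le ?_)
    exact (h β hβ).2
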